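/- Conventions. Bimodal formulas are built from countably infinitely many propositional variables with $\neg$, $\wedge$ and the diamonds $\Diamond_0,\Diamond_1$ (with $\Box_i=\neg\Diamond_i\neg$); unimodal formulas have one diamond. A frame is a non-empty set with one binary relation for each diamond, and a model adds a valuation of the propositional variables; truth at a point and validity in a frame are as usual in Kripke semantics. A bimodal logic is a set of bimodal formulas that contains all propositional tautologies and all formulas $\Box_i(p\to q)\to(\Box_i p\to\Box_i q)$, and is closed under substitution, modus ponens and necessitation for $\Box_0$ and $\Box_1$. For a bimodal logic $L$, $L$-satisfiability is the problem: given a bimodal formula $\varphi$, is $\varphi$ true at some point of some model in which every formula of $L$ is true at every point? A frame is a frame for $L$ if every formula of $L$ is valid in it. $\mathbf{K4.3}$ is the set of unimodal formulas valid in all (irreflexive) linear orders, and $\mathbf{Diff}$ the set of unimodal formulas valid in all frames $\langle W,\neq\rangle$. The commutator $[\mathbf{K4.3},\mathbf{Diff}]$ is the smallest bimodal logic that contains $\mathbf{K4.3}$ (written with $\Diamond_0$), $\mathbf{Diff}$ (written with $\Diamond_1$) and the formulas $\Box_1\Box_0 p\to\Box_0\Box_1 p$, $\Box_0\Box_1 p\to\Box_1\Box_0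 p$ and $\Diamond_0\Box_1 p\to\Box_1\Diamond_0 p$. The product $\langle W_0,R_0\rangle\times\langle W_1,R_1\rangle$ is the bimodal frame on $W_0\times W_1$ whose first relation changes the first coordinate along $R_0$ and keeps the second, and whose second relation changes the second coordinate along $R_1$ and keeps the first. $\mathbf{K4.3}\times\mathbf{Diff}$ is the set of bimodal formulas valid in all products of a frame for $\mathbf{K4.3}$ and a frame for $\mathbf{Diff}$. Theorem. Let $L$ be any bimodal logic, not necessarily Kripke complete, such that $L$ contains $[\mathbf{K4.3},\mathbf{Diff}]$ and $\langle\omega+1,>\rangle\times\langle\omega,\neq\rangle$ is a frame for $L$. Then $L$-satisfiability is undecidable. Moreover, the logics $[\mathbf{K4.3},\mathbf{Diff}]$ and $\mathbf{K4.3}\times\mathbf{Diff}$ are undecidable, that is, there is no algorithm that decides whether a given bimodal formula belongs to the logic, for either of the two. -/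

import Mathlib

universe u

namespace Modal

/-- Modal formulas whose diamonds are indexed by `ι`, over the propositional variables
`var 0, var 1, …`. Unimodal formulas are `Formula Unit`, bimodal ones are `Formula (Fin 2)`. -/
inductive Formula (ι : Type) : Type where
  | var : ℕ → Formula ι
  | neg : Formula ι → Formula ι
  | and : Formula ι → Formula ι → Formula ι
  | dia : ι → Formula ι → Formula ι

abbrev UnimodalFormula : Type := Formula Unit

abbrev BimodalFormula : Type := Formula (Fin 2)

namespace Formula

variable {ι κ : Type}

/-- `φ → ψ`, as an abbreviation. -/
def imp (φ ψ : Formula ι) : Formula ι := neg (and φ (neg ψ))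

/-- `□ᵢ φ`, as an abbreviation. -/
def box (i : ι) (φ : Formula ι) : Formula ι := neg (dia i (neg φ))

/-- Uniform substitution of formulas for propositional variables. -/
def subst (σ : ℕ → Formula ι) : Formula ι → Formula ι
  | var n => σ n
  | neg φ => neg (subst σ φ)
  | and φ ψ => and (subst σ φ) (subst σ ψ)
  | dia i φ => dia i (subst σ φ)

/-- Replace every modal operator `◇ᵢ` by `◇_{f i}`. -/
def mapModality (f : ι → κ) : Formula ι → Formula κ
  | var n => var n
  | neg φ => neg (mapModality f φ)
  | and φ ψ => and (mapModality f φ) (mapModality f ψ)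
  | dia i φ => dia (f i) (mapModality f φ)

/-- A unimodal formula, read as a bimodal formula in the language with `◇ᵢ` only. -/
def toBimodal (i : Fin 2) (φ : UnimodalFormula) : BimodalFormula := mapModality (fun _ => i) φ

/-- Propositional tautologies: true under every Boolean valuation, where variables and formulas
of the form `◇ᵢ φ` count as atoms. -/
def IsTautology (φ : Formula ι) : Prop :=
  ∀ v : Formula ι → Prop, (∀ ψ, v (neg ψ) ↔ ¬ v ψ) → (∀ ψ χ, v (and ψ χ) ↔ v ψ ∧ v χ) → v φ

/-! A Gödel numbering of the bimodal formulas. -/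

/-- The Gödel number of a bimodal formula. -/
def toNat : BimodalFormula → ℕ
  | var n => 5 * n
  | neg φ => 5 * toNat φ + 1
  | and φ ψ => 5 * Nat.pair (toNat φ) (toNat ψ) + 2
  | dia i φ => 5 * toNat φ + 3 + i.val

/-- The bimodal formula with a given Gödel number. -/
def ofNat (n : ℕ) : BimodalFormula :=
  if n % 5 = 0 then var (n / 5)
  else if n % 5 = 1 then neg (ofNat (n / 5))
  else if n % 5 = 2 then and (ofNat (n / 5).unpair.1) (ofNat (n / 5).unpair.2)
  else if n % 5 = 3 then dia 0 (ofNat (n / 5))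
  else dia 1 (ofNat (n / 5))
termination_by n
decreasing_by
  · omega
  · have := Nat.unpair_left_le (n / 5); omega
  · have := Nat.unpair_right_le (n / 5); omega
  · omega
  · omega

theorem ofNat_toNat (φ : BimodalFormula) : ofNat (toNat φ) = φ := by
  induction φ with
  | var n => rw [ofNat]; simp [toNat]
  | neg φ ih =>
    have h1 : (5 * toNat φ + 1) % 5 = 1 := by omega
    have h2 : (5 * toNat φ + 1) / 5 = toNat φ := by omega
    rw [ofNat]; simp [toNat, h1, h2, ih]
  | and φ ψ ih1 ih2 =>
    have h1 : (5 * Nat.pair (toNat φ) (toNat ψ) + 2) % 5 = 2 := by omega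
    have h2 : (5 * Nat.pair (toNat φ) (toNat ψ) + 2) / 5 = Nat.pair (toNat φ) (toNat ψ) := by
      omega
    rw [ofNat]; simp [toNat, h1, h2, ih1, ih2]
  | dia i φ ih =>
    have h2 : (5 * toNat φ + 3 + i.val) / 5 = toNat φ := by omega
    have h1 : (5 * toNat φ + 3 + i.val) % 5 = 3 + i.val := by omega
    rw [ofNat]
    simp only [toNat, h1, h2, ih]
    fin_cases i <;> simp

theorem toNat_ofNat (n : ℕ) : toNat (ofNat n) = n := by
  induction n using Nat.strong_induction_on with
  | _ n ih =>
    rw [ofNat]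
    split_ifs with h0 h1 h2 h3
    · simp only [toNat]; omega
    · have := ih (n / 5) (by omega)
      simp only [toNat, this]; omega
    · have a1 := ih (n / 5).unpair.1 (by have := Nat.unpair_left_le (n / 5); omega)
      have a2 := ih (n / 5).unpair.2 (by have := Nat.unpair_right_le (n / 5); omega)
      simp only [toNat, a1, a2, Nat.pair_unpair]; omega
    · have := ih (n / 5) (by omega)
      simp only [toNat, this, Fin.val_zero]; omega
    · have := ih (n / 5) (by omega)
      simp only [toNat, this, Fin.val_one]; omega

/-- The Gödel numbering is a bijection with `ℕ`, and it is this coding to which computability of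
predicates on bimodal formulas refers. -/
instance instDenumerableBimodal : Denumerable BimodalFormula :=
  Denumerable.mk' ⟨toNat, ofNat, ofNat_toNat, toNat_ofNat⟩

end Formula

open Formula

/-- A Kripke frame: a non-empty set with one binary relation for each modality. -/
structure Frame (ι : Type) : Type (u + 1) where
  W : Type u
  nonempty : Nonempty W
  R : ι → W → W → Prop

/-- The truth relation, in the model given by the frame `F` and the valuation `ν`. -/
def Truth {ι : Type} (F : Frame.{u} ι) (ν : ℕ → Set F.W) : F.W → Formula ι → Prop
  | w, .var n => w ∈ ν n
  | w, .neg φ => ¬ Truth F ν w φ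
  | w, .and φ ψ => Truth F ν w φ ∧ Truth F ν w ψ
  | w, .dia i φ => ∃ v, F.R i w v ∧ Truth F ν v φ

/-- Validity of a formula in a frame. -/
def Valid {ι : Type} (F : Frame.{u} ι) (φ : Formula ι) : Prop :=
  ∀ (ν : ℕ → Set F.W) (w : F.W), Truth F ν w φ

/-- `F` is a frame for the set `S` of formulas. -/
def IsFrameFor {ι : Type} (F : Frame.{u} ι) (S : Set (Formula ι)) : Prop :=
  ∀ φ ∈ S, Valid F φ

/-- The class of all frames for a set of formulas. -/
def Fr {ι : Type} (S : Set (Formula ι)) : Set (Frame.{u} ι) := {F | IsFrameFor F S}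

/-- The set of formulas valid in every member of a class of frames. -/
def Log {ι : Type} (C : Set (Frame.{u} ι)) : Set (Formula ι) := {φ | ∀ F ∈ C, Valid F φ}

/-- Normal modal logics, as sets of formulas. -/
structure IsLogic {ι : Type} (L : Set (Formula ι)) : Prop where
  taut : ∀ φ, IsTautology φ → φ ∈ L
  axiomK : ∀ (i : ι) (φ ψ : Formula ι),
    imp (box i (imp φ ψ)) (imp (box i φ) (box i ψ)) ∈ L
  substitution : ∀ (σ : ℕ → Formula ι), ∀ φ ∈ L, subst σ φ ∈ L
  modusPonens : ∀ φ ψ, imp φ ψ ∈ L → φ ∈ L → ψ ∈ L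
  necessitation : ∀ (i : ι), ∀ φ ∈ L, box i φ ∈ L

/-- `L`-satisfiability: `φ` is satisfied in some model (not just on some frame for `L`) in which
all formulas of `L` are true at all points. -/
def Satisfiable {ι : Type} (L : Set (Formula ι)) (φ : Formula ι) : Prop :=
  ∃ (F : Frame.{u} ι) (ν : ℕ → Set F.W),
    (∀ ψ ∈ L, ∀ w, Truth F ν w ψ) ∧ ∃ w, Truth F ν w φ

/-- The smallest logic that contains `S`. -/
def smallestLogic {ι : Type} (S : Set (Formula ι)) : Set (Formula ι) :=
  {φ | ∀ L : Set (Formula ι), IsLogic L → S ⊆ L → φ ∈ L}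

/-- The fusion of two unimodal logics. -/
def fusion (L₀ L₁ : Set UnimodalFormula) : Set BimodalFormula :=
  smallestLogic (toBimodal 0 '' L₀ ∪ toBimodal 1 '' L₁)

/-- The two commutativity formulas and the confluence formula. -/
def commutationFormulas : Set BimodalFormula :=
  {imp (box 1 (box 0 (var 0))) (box 0 (box 1 (var 0))),
   imp (box 0 (box 1 (var 0))) (box 1 (box 0 (var 0))),
   imp (dia 0 (box 1 (var 0))) (box 1 (dia 0 (var 0)))}

/-- The commutator `[L₀, L₁]` of two unimodal logics. -/
def commutatorLogic (L₀ L₁ : Set UnimodalFormula) : Set BimodalFormula :=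
  smallestLogic (fusion L₀ L₁ ∪ commutationFormulas)

/-- The product of two unimodal frames. -/
def Frame.prod (F₀ F₁ : Frame.{u} Unit) : Frame.{u} (Fin 2) where
  W := F₀.W × F₁.W
  nonempty := have := F₀.nonempty; have := F₁.nonempty; inferInstance
  R i x y := if i = 0 then F₀.R () x.1 y.1 ∧ x.2 = y.2 else F₁.R () x.2 y.2 ∧ x.1 = y.1

/-- The product `L₀ × L₁` of two unimodal logics: the logic determined by the class of all
products of a frame for `L₀` and a frame for `L₁`. -/
def productLogic (L₀ L₁ : Set UnimodalFormula) : Set BimodalFormula :=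
  Log {F : Frame.{u} (Fin 2) | ∃ F₀ ∈ Fr.{u} L₀, ∃ F₁ ∈ Fr.{u} L₁, F = F₀.prod F₁}

/-- The class of all (irreflexive) linear orders. -/
def linearFrames : Set (Frame.{u} Unit) :=
  {F | (∀ x, ¬ F.R () x x) ∧ (∀ x y z, F.R () x y → F.R () y z → F.R () x z) ∧
    ∀ x y, F.R () x y ∨ x = y ∨ F.R () y x}

/-- The class of all difference frames `⟨W, ≠⟩`. -/
def differenceFrames : Set (Frame.{u} Unit) :=
  {F | ∀ x y, F.R () x y ↔ x ≠ y}

/-- `K4.3`, the unimodal logic of all linear orders. -/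
def K43 : Set UnimodalFormula := Log linearFrames.{u}

/-- `Diff`, the unimodal logic of all difference frames. -/
def Diff : Set UnimodalFormula := Log differenceFrames.{u}

/-- The frame `⟨ω + 1, >⟩`; its points are the finite ordinals and the top element `ω`. -/
def omegaSuccGt : Frame.{0} Unit where
  W := WithTop ℕ
  nonempty := inferInstance
  R _ x y := x > y

/-- The frame `⟨ω, ≠⟩`. -/
def omegaNe : Frame.{0} Unit where
  W := ℕ
  nonempty := inferInstance
  R _ x y := x ≠ y

end Modal

open Modal

/-! The halting problem of one finite-state counter machine is reduced to satisfiability. For an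
input `m`, the formula `reduction` is refuted by `[K4.3, Diff]` if the machine halts
(`neg_reduction_mem`), and is true in a model on the grid ⟨ω+1,>⟩ × ⟨ω,≠⟩ if it does not
(`grid_truth_reduction`). This covers every `L` between the commutator and the logic of the grid:
what the commutator refutes is not `L`-satisfiable, and a model on a frame for `L` is an `L`-model.
Completeness of `L` plays no role. The negated formula likewise decides membership in the commutator
and in the product logic.

Time is depth: a row (a class of points that are equal or related by the second relation) whose
longest chain downwards has length `n` stands for time `n`. There is no next-time operator, so the
formula builds a ladder. Immediately over the diagonal point ⟨n,n⟩ lies the point ⟨n+1,n⟩ of the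
same column, and the row of the latter contains the next diagonal point ⟨n+1,n+1⟩. Configurations
are read at diagonal points and written to the row one step up.

Marks persist in time, so a counter is stored as a difference of two growing sets, the elements
added and the elements removed; the difference modality says that exactly one element is new. In
frames that are not products, points may be reflexive for the second relation and columns may split.
The counted points are kept irreflexive, and columns cannot split over such a point
(`reflexive_of_common_succ`), so `counts_old` carries cardinalities exactly from row to row. The
induction along the ladder is `exists_records`.

The syntactic side is a canonical model argument: the canonical frame of any extension of the
commutator is an `IsCommutatorFrame` (`exists_truth`). The machine comes from
`exists_undecidable_counterMachine`, by compiling primitive recursive functions to while programs.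
-/

/-! ### Counter machines and while programs -/

/-- The effect of an action on the counters: `(i, true)` increments and `(i, false)` decrements
counter `i`. -/
def updateCounters : Option (ℕ × Bool) → (ℕ → ℕ) → ℕ → ℕ
  | none, s => s
  | some (i, true), s => Function.update s i (s i + 1)
  | some (i, false), s => Function.update s i (s i - 1)

/-- Deterministic counter machines: in state `q`, the counter `test q` is compared with `0`, and
the outcome determines an action and the next state. Only the counter just found to be positive may
be decremented. -/
structure CounterMachine (σ : Type) where
  start : σ
  halt : σ
  test : σ → ℕ
  act : σ → Bool → Option (ℕ × Bool)
  next : σ → Bool → σ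
  guarded : ∀ q z i, act q z = some (i, false) → i = test q ∧ z = false

namespace CounterMachine

variable {σ : Type} (M : CounterMachine σ)

/-- One step of a counter machine. -/
def step (c : σ × (ℕ → ℕ)) : σ × (ℕ → ℕ) :=
  (M.next c.1 (decide (c.2 (M.test c.1) = 0)),
    updateCounters (M.act c.1 (decide (c.2 (M.test c.1) = 0))) c.2)

/-- The machine reaches its halting state from the input `m` in counter `0`. -/
def Halts (m : ℕ) : Prop :=
  ∃ n, (M.step^[n] (M.start, Function.update 0 0 m)).1 = M.halt

end CounterMachine

/-- While programs over registers that are indexed by `ℕ`. -/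
inductive Cmd : Type
  | inc : ℕ → Cmd
  | dec : ℕ → Cmd
  | seq : Cmd → Cmd → Cmd
  | loop : ℕ → Cmd → Cmd

namespace Cmd

def test : List Cmd → ℕ
  | inc i :: _ => i
  | dec i :: _ => i
  | loop i _ :: _ => i
  | _ => 0

/-- A `dec` on a zero counter falls through to `none`. This makes `machine` guarded and agrees with
truncated subtraction in `run_dec`. -/
def act : List Cmd → Bool → Option (ℕ × Bool)
  | inc i :: _, _ => some (i, true)
  | dec i :: _, false => some (i, false)
  | _, _ => none

def next : List Cmd → Bool → List Cmd
  | [], _ => []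
  | inc _ :: K, _ => K
  | dec _ :: K, _ => K
  | seq a b :: K, _ => a :: b :: K
  | loop _ _ :: K, true => K
  | loop i a :: K, false => a :: loop i a :: K

/-- The machine whose states are the continuations of a program. -/
def machine (c : Cmd) : CounterMachine (List Cmd) where
  start := [c]
  halt := []
  test := test
  act := act
  next := next
  guarded q z i h := by
    match q, z with
    | [], _ => simp [act] at h
    | inc j :: K, z => simp [act] at h
    | dec j :: K, true => simp [act] at h
    | dec j :: K, false => simp [act] at h; simp [test, h]
    | seq a b :: K, z => simp [act] at h
    | loop j a :: K, z => simp [act] at h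

/-- The step function on continuations, which does not depend on the program. -/
def step (c : List Cmd × (ℕ → ℕ)) : List Cmd × (ℕ → ℕ) :=
  (next c.1 (decide (c.2 (test c.1) = 0)), updateCounters (act c.1 (decide (c.2 (test c.1) = 0))) c.2)

/-- The continuations that occur when `c` is run before `K`. -/
def continuations : Cmd → List Cmd → Set (List Cmd)
  | inc i, K => {inc i :: K}
  | dec i, K => {dec i :: K}
  | seq a b, K => {seq a b :: K} ∪ (continuations a (b :: K) ∪ continuations b K)
  | loop i a, K => {loop i a :: K} ∪ continuations a (loop i a :: K)

theorem finite_continuations (c : Cmd) (K : List Cmd) : (continuations c K).Finite := by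
  induction c generalizing K with
  | inc | dec => exact Set.finite_singleton _
  | seq a b iha ihb => exact (Set.finite_singleton _).union ((iha _).union (ihb _))
  | loop i a ih => exact (Set.finite_singleton _).union (ih _)

theorem cons_mem_continuations (c : Cmd) (K : List Cmd) : c :: K ∈ continuations c K := by
  cases c <;> simp [continuations]

/-- Closure under transitions up to the exit `K`. For `K = []` it yields a finite closed set of
states once `[]` is inserted. -/
theorem next_mem_continuations (c : Cmd) (K q : List Cmd) (z : Bool) (hq : q ∈ continuations c K) :
    next q z = K ∨ next q z ∈ continuations c K := by
  induction c generalizing K with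
  | inc i => simp only [continuations, Set.mem_singleton_iff] at hq; subst hq; exact Or.inl rfl
  | dec i => simp only [continuations, Set.mem_singleton_iff] at hq; subst hq; exact Or.inl rfl
  | seq a b iha ihb =>
    rcases hq with hq | hq | hq
    · rw [Set.mem_singleton_iff] at hq; subst hq
      exact Or.inr (Or.inr (Or.inl (cons_mem_continuations _ _)))
    · rcases iha _ hq with h | h
      · rw [h]; exact Or.inr (Or.inr (Or.inr (cons_mem_continuations _ _)))
      · exact Or.inr (Or.inr (Or.inl h))
    · rcases ihb _ hq with h | h
      · exact Or.inl h
      · exact Or.inr (Or.inr (Or.inr h))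
  | loop i a ih =>
    rcases hq with hq | hq
    · rw [Set.mem_singleton_iff] at hq; subst hq
      cases z
      · exact Or.inr (Or.inr (cons_mem_continuations _ _))
      · exact Or.inl rfl
    · rcases ih _ hq with h | h
      · rw [h]; exact Or.inr (Or.inl rfl)
      · exact Or.inr (Or.inr h)

/-- The program `c` terminates on the store `s`, with the store `t`. -/
def Run (c : Cmd) (s t : ℕ → ℕ) : Prop :=
  ∀ K, ∃ n, step^[n] (c :: K, s) = (K, t)

theorem run_inc (i : ℕ) (s : ℕ → ℕ) : Run (inc i) s (Function.update s i (s i + 1)) :=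
  fun _ => ⟨1, rfl⟩

theorem run_dec (i : ℕ) (s : ℕ → ℕ) : Run (dec i) s (Function.update s i (s i - 1)) := by
  intro K
  refine ⟨1, ?_⟩
  by_cases h : s i = 0
  · have : Function.update s i 0 = s := by rw [← h]; exact Function.update_eq_self i s
    simp [step, next, act, test, h, updateCounters, this]
  · simp [step, next, act, test, h, updateCounters]

theorem Run.seq {a b : Cmd} {s t r : ℕ → ℕ} (ha : Run a s t) (hb : Run b t r) :
    Run (seq a b) s r := by
  intro K
  obtain ⟨n, hn⟩ := ha (b :: K)
  obtain ⟨k, hk⟩ := hb K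
  refine ⟨k + (n + 1), ?_⟩
  rw [Function.iterate_add_apply, Function.iterate_succ_apply]
  change step^[k] (step^[n] (a :: b :: K, s)) = _
  rw [hn, hk]

theorem step_loop_zero {i : ℕ} {a : Cmd} {K : List Cmd} {s : ℕ → ℕ} (h : s i = 0) :
    step (loop i a :: K, s) = (K, s) := by
  simp [step, next, act, test, h, updateCounters]

theorem step_loop_pos {i : ℕ} {a : Cmd} {K : List Cmd} {s : ℕ → ℕ} (h : s i ≠ 0) :
    step (loop i a :: K, s) = (a :: loop i a :: K, s) := by
  simp [step, next, act, test, h, updateCounters]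

theorem run_loop_zero {i : ℕ} {a : Cmd} {s : ℕ → ℕ} (h : s i = 0) : Run (loop i a) s s :=
  fun _ => ⟨1, step_loop_zero h⟩

theorem run_loop_pos {i : ℕ} {a : Cmd} {s t r : ℕ → ℕ} (h : s i ≠ 0) (ha : Run a s t)
    (hl : Run (loop i a) t r) : Run (loop i a) s r := by
  intro K
  obtain ⟨n, hn⟩ := ha (loop i a :: K)
  obtain ⟨k, hk⟩ := hl K
  refine ⟨k + (n + 1), ?_⟩
  rw [Function.iterate_add_apply, Function.iterate_succ_apply, step_loop_pos h, hn, hk]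

/-- A loop whose body decrements the loop register, with invariant `P`. -/
theorem exists_run_loop {i : ℕ} {a : Cmd} (P : ℕ → (ℕ → ℕ) → Prop)
    (h : ∀ n s, s i = n + 1 → P (n + 1) s → ∃ t, Run a s t ∧ t i = n ∧ P n t) (s : ℕ → ℕ)
    (hs : P (s i) s) : ∃ t, Run (loop i a) s t ∧ t i = 0 ∧ P 0 t := by
  obtain ⟨n, hn⟩ : ∃ n, s i = n := ⟨_, rfl⟩
  induction n generalizing s with
  | zero => exact ⟨s, run_loop_zero hn, hn, hn ▸ hs⟩
  | succ n ih =>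
    obtain ⟨t, ht, hti, hP⟩ := h n s hn (hn ▸ hs)
    obtain ⟨r, hr, hri, hr0⟩ := ih t (hti.symm ▸ hP) hti
    exact ⟨r, run_loop_pos (by omega) ht hr, hri, hr0⟩

theorem exists_run_clear (i : ℕ) : ∃ c, ∀ s, Run c s (Function.update s i 0) := by
  refine ⟨loop i (dec i), fun s => ?_⟩
  obtain ⟨t, ht, h0, h⟩ := exists_run_loop (i := i) (a := dec i)
    (fun _ t => ∀ r, r ≠ i → t r = s r) (fun n t htn hP => ⟨_, run_dec i t, by simp [htn], by
      intro r hr; simp [hr, hP r hr]⟩) s (fun _ _ => rfl)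
  convert ht using 1
  ext r
  by_cases hr : r = i
  · subst hr; simp [h0]
  · simp [hr, h r hr]

/-- Copying register `i` to register `j`, with the help of a scratch register `k`. -/
theorem exists_run_copy (i j k : ℕ) (hij : i ≠ j) (hik : i ≠ k) (hjk : j ≠ k) :
    ∃ c, ∀ s, ∃ t, Run c s t ∧ t j = s i ∧ ∀ r, r ≠ j → r ≠ k → t r = s r := by
  obtain ⟨cj, hcj⟩ := exists_run_clear j
  obtain ⟨ck, hck⟩ := exists_run_clear k
  -- Draining `i` into `k` destroys `i`, so the second loop drains `k` into `i` and `j`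
  -- simultaneously.
  refine ⟨seq (seq cj ck) (seq (loop i (seq (dec i) (inc k)))
    (loop k (seq (dec k) (seq (inc i) (inc j))))), fun s => ?_⟩
  have h1 := (hcj s).seq (hck _)
  set s₁ := Function.update (Function.update s j 0) k 0 with hs₁
  obtain ⟨s₂, h2, e₀, hs₂⟩ := exists_run_loop (i := i) (a := seq (dec i) (inc k))
    (fun n t => t k + n = s i ∧ t j = 0 ∧ ∀ r, r ≠ i → r ≠ j → r ≠ k → t r = s r)
    (fun n t htn hP => ⟨_, (run_dec i t).seq (run_inc k _), by simp [htn, hik], by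
      refine ⟨?_, ?_, fun r hi hj hk => ?_⟩
      · simp [hik.symm]; omega
      · simp [hjk, hij.symm, hP.2.1]
      · simp [hi, hk, hP.2.2 r hi hj hk]⟩) s₁ (by
      refine ⟨?_, ?_, fun r hi hj hk => ?_⟩
      · simp [hs₁, hik, hij]
      · simp [hs₁, hjk]
      · simp [hs₁, hj, hk])
  obtain ⟨t, h3, -, ht⟩ := exists_run_loop (i := k) (a := seq (dec k) (seq (inc i) (inc j)))
    (fun n t => t i + n = s i ∧ t j + n = s i ∧ ∀ r, r ≠ i → r ≠ j → r ≠ k → t r = s r)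
    (fun n t htn hP => ⟨_, (run_dec k t).seq ((run_inc i _).seq (run_inc j _)), by
        simp [htn, hik.symm, hjk.symm], by
      refine ⟨?_, ?_, fun r hi hj hk => ?_⟩
      · simp [hik, hij]; omega
      · simp [hjk, hij.symm]; omega
      · simp [hi, hj, hk, hP.2.2 r hi hj hk]⟩) s₂ (by
      obtain ⟨e₁, e₂, e₃⟩ := hs₂
      exact ⟨by omega, by omega, e₃⟩)
  refine ⟨t, h1.seq (h2.seq h3), by simpa using ht.2.1, fun r hj hk => ?_⟩
  by_cases hi : r = i
  · subst hi; simpa using ht.1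
  · exact ht.2.2 r hi hj hk

/-! ### Primitive recursive functions and unbounded search as while programs -/

/-- `f` is computed by programs that read the registers `ins`, write the register `out` and use
the registers from `b` on as scratch space. -/
def Computes {n : ℕ} (f : List.Vector ℕ n → ℕ) : Prop :=
  ∀ (ins : Fin n → ℕ) (out b : ℕ), (∀ i, ins i < b) → out < b → (∀ i, ins i ≠ out) →
    ∃ c, ∀ s, ∃ t, Run c s t ∧ t out = f (List.Vector.ofFn fun i => s (ins i)) ∧
      ∀ r, r < b → r ≠ out → t r = s r

theorem computes_zero : Computes (n := 0) fun _ => 0 := by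
  intro ins out b _ _ _
  obtain ⟨c, hc⟩ := exists_run_clear out
  exact ⟨c, fun s => ⟨_, hc s, by simp, fun r _ hr => by simp [hr]⟩⟩

theorem computes_get {n : ℕ} (i : Fin n) : Computes fun v => v.get i := by
  intro ins out b hb ho hne
  obtain ⟨c, hc⟩ := exists_run_copy (ins i) out b (hne i) (hb i).ne ho.ne
  refine ⟨c, fun s => ?_⟩
  obtain ⟨t, h1, h2, h3⟩ := hc s
  exact ⟨t, h1, by simp [h2], fun r hr hro => h3 r hro hr.ne⟩

theorem computes_succ : Computes (n := 1) fun v => v.head.succ := by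
  intro ins out b hb ho hne
  obtain ⟨c, hc⟩ := computes_get (0 : Fin 1) ins out b hb ho hne
  refine ⟨seq c (inc out), fun s => ?_⟩
  obtain ⟨t, h1, h2, h3⟩ := hc s
  refine ⟨_, h1.seq (run_inc out t), ?_, fun r hr hro => ?_⟩
  · simp only [List.Vector.get_zero] at h2
    simp [h2]
  · simp [hro, h3 r hr hro]

/-- Results are stored in consecutive registers from `b` on, with scratch space beyond `b + n`, so
that later computations leave the earlier results intact. -/
theorem exists_run_family {n m : ℕ} (g : Fin n → List.Vector ℕ m → ℕ) (hg : ∀ i, Computes (g i))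
    (ins : Fin m → ℕ) (b : ℕ) (hb : ∀ i, ins i < b) (k : ℕ) (hk : k ≤ n) :
    ∃ c, ∀ s, ∃ t, Run c s t ∧
      (∀ i : Fin n, i.val < k → t (b + i) = g i (List.Vector.ofFn fun i => s (ins i))) ∧
      ∀ r, r < b → t r = s r := by
  induction k with
  | zero =>
    obtain ⟨c, hc⟩ := exists_run_clear b
    exact ⟨c, fun s => ⟨_, hc s, by simp, fun r hr => by simp [hr.ne]⟩⟩
  | succ k ih =>
    obtain ⟨c, hc⟩ := ih (by omega)
    obtain ⟨d, hd⟩ := hg ⟨k, hk⟩ ins (b + k) (b + n) (fun i => by have := hb i; omega) (by omega)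
      (fun i => by have := hb i; omega)
    refine ⟨seq c d, fun s => ?_⟩
    obtain ⟨t, h1, h2, h3⟩ := hc s
    obtain ⟨r, h4, h5, h6⟩ := hd t
    have hv : (fun i => t (ins i)) = fun i => s (ins i) := funext fun i => h3 _ (hb i)
    rw [hv] at h5
    refine ⟨r, h1.seq h4, fun i hi => ?_, fun j hj => ?_⟩
    · by_cases hik : i.val = k
      · obtain rfl : i = ⟨k, hk⟩ := Fin.ext hik
        exact h5
      · rw [h6 _ (by omega) (by omega), h2 i (by omega)]
    · rw [h6 _ (by omega) (by omega), h3 j hj]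

theorem computes_comp {n m : ℕ} {f : List.Vector ℕ n → ℕ} (g : Fin n → List.Vector ℕ m → ℕ)
    (hf : Computes f) (hg : ∀ i, Computes (g i)) :
    Computes fun v => f (List.Vector.ofFn fun i => g i v) := by
  intro ins out b hb ho hne
  obtain ⟨c, hc⟩ := exists_run_family g hg ins b hb n le_rfl
  obtain ⟨d, hd⟩ := hf (fun i => b + i) out (b + n) (fun i => by omega) (by omega)
    (fun i => by omega)
  refine ⟨seq c d, fun s => ?_⟩
  obtain ⟨t, h1, h2, h3⟩ := hc s
  obtain ⟨r, h4, h5, h6⟩ := hd t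
  refine ⟨r, h1.seq h4, ?_, fun j hj hjo => ?_⟩
  · rw [h5]
    simp only [h2 _ (Fin.is_lt _)]
  · rw [h6 j (by omega) hjo, h3 j hj]

/-- Register `b` counts the remaining rounds down, `b + 1` counts the finished rounds up, and `out`
holds the accumulator. The value of `g` goes to `b + 2` first, since an output register must differ
from the inputs and `out` is one of them. -/
theorem computes_prec {n : ℕ} {f : List.Vector ℕ n → ℕ} {g : List.Vector ℕ (n + 2) → ℕ}
    (hf : Computes f) (hg : Computes g) :
    Computes fun v : List.Vector ℕ (n + 1) =>
      v.head.rec (f v.tail) fun y IH => g (y ::ᵥ IH ::ᵥ v.tail) := by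
  intro ins out b hb ho hne
  have hb' : ∀ i : Fin n, ins i.succ < b := fun i => hb _
  obtain ⟨c₁, hc₁⟩ := exists_run_copy (ins 0) b (b + 1) (hb 0).ne (by have := hb 0; omega) (by omega)
  obtain ⟨c₂, hc₂⟩ := exists_run_clear (b + 1)
  obtain ⟨c₃, hc₃⟩ := hf (fun i => ins i.succ) out (b + 2) (fun i => by have := hb' i; omega)
    (by omega) (fun i => hne _)
  obtain ⟨d₁, hd₁⟩ := hg (Fin.cons (b + 1) (Fin.cons out fun i => ins i.succ)) (b + 2) (b + 3)
    (fun i => by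
      refine Fin.cases ?_ (fun i => ?_) i
      · simp
      · refine Fin.cases ?_ (fun i => ?_) i
        · simp only [Fin.cons_succ, Fin.cons_zero]; omega
        · have := hb' i; simp only [Fin.cons_succ]; omega) (by omega)
    (fun i => by
      refine Fin.cases ?_ (fun i => ?_) i
      · simp
      · refine Fin.cases ?_ (fun i => ?_) i
        · simp only [Fin.cons_succ, Fin.cons_zero]; omega
        · have := hb' i; simp only [Fin.cons_succ]; omega)
  obtain ⟨d₂, hd₂⟩ := exists_run_copy (b + 2) out (b + 3) (by omega) (by omega) (by omega)
  refine ⟨seq (seq c₁ (seq c₂ c₃))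
    (loop b (seq (dec b) (seq d₁ (seq d₂ (inc (b + 1)))))), fun s => ?_⟩
  obtain ⟨s₁, r₁, e₁, u₁⟩ := hc₁ s
  have r₂ := hc₂ s₁
  obtain ⟨s₃, r₃, e₃, u₃⟩ := hc₃ (Function.update s₁ (b + 1) 0)
  set v := List.Vector.ofFn fun i => s (ins i) with hv
  have htail : v.tail = List.Vector.ofFn fun i : Fin n => s (ins i.succ) := by
    rw [hv, List.Vector.ofFn]; rfl
  have hhead : v.head = s (ins 0) := by rw [hv, List.Vector.ofFn]; rfl
  let F : ℕ → ℕ := fun k => k.rec (f v.tail) fun y IH => g (y ::ᵥ IH ::ᵥ v.tail)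
  have hs₃ : ∀ r, r < b → r ≠ out → s₃ r = s r := fun r hr hro => by
    rw [u₃ r (by omega) hro, Function.update_of_ne (by omega), u₁ r hr.ne (by omega)]
  have hs₃b : s₃ b = v.head := by
    rw [u₃ b (by omega) ho.ne', Function.update_of_ne (by omega), e₁, hhead]
  have hs₃b1 : s₃ (b + 1) = 0 := by
    rw [u₃ _ (by omega) (by omega), Function.update_self]
  have hs₃o : s₃ out = F 0 := by
    rw [e₃]
    change _ = f v.tail
    rw [htail]
    congr 2
    funext i
    rw [Function.update_of_ne (by have := hb' i; omega), u₁ _ (hb _).ne (by have := hb' i; omega)]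
  obtain ⟨t, r₄, -, ht⟩ := exists_run_loop (i := b)
    (a := seq (dec b) (seq d₁ (seq d₂ (inc (b + 1)))))
    (fun k t => t (b + 1) + k = v.head ∧ t out = F (t (b + 1)) ∧
      ∀ r, r < b → r ≠ out → t r = s r)
    (fun k t htk hP => by
      obtain ⟨t₁, q₁, w₁, x₁⟩ := hd₁ (Function.update t b (t b - 1))
      obtain ⟨t₂, q₂, w₂, x₂⟩ := hd₂ t₁
      have hy : t₂ (b + 1) = t (b + 1) := by
        rw [x₂ _ (by omega) (by omega), x₁ _ (by omega) (by omega),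
          Function.update_of_ne (by omega)]
      refine ⟨_, (run_dec b t).seq (q₁.seq (q₂.seq (run_inc (b + 1) t₂))), ?_, ?_, ?_, ?_⟩
      · rw [Function.update_of_ne (by omega), x₂ _ (by omega) (by omega),
          x₁ _ (by omega) (by omega), Function.update_self, htk]
        rfl
      · rw [Function.update_self, hy]; omega
      · rw [Function.update_self, Function.update_of_ne (by omega), w₂, w₁, hy]
        change _ = g (t (b + 1) ::ᵥ F (t (b + 1)) ::ᵥ v.tail)
        rw [← hP.2.1, htail]
        have : (fun i => Function.update t b (t b - 1)
            ((Fin.cons (b + 1) (Fin.cons out fun i => ins i.succ) : Fin (n + 2) → ℕ) i)) =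
            Fin.cons (t (b + 1)) (Fin.cons (t out) fun i : Fin n => s (ins i.succ)) := by
          funext i
          refine Fin.cases ?_ (fun i => ?_) i
          · simp
          · refine Fin.cases ?_ (fun i => ?_) i
            · simp only [Fin.cons_succ, Fin.cons_zero]
              rw [Function.update_of_ne (by omega)]
            · simp only [Fin.cons_succ]
              rw [Function.update_of_ne (by have := hb' i; omega), hP.2.2 _ (hb' i) (hne _)]
        rw [this]
        simp [List.Vector.ofFn]
      · intro r hr hro
        rw [Function.update_of_ne (by omega), x₂ _ hro (by omega), x₁ _ (by omega) (by omega),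
          Function.update_of_ne (by omega), hP.2.2 r hr hro]) s₃
    ⟨by omega, by rw [hs₃b1, hs₃o], hs₃⟩
  refine ⟨t, (r₁.seq (r₂.seq r₃)).seq r₄, ?_, ht.2.2⟩
  rw [ht.2.1, show t (b + 1) = v.head by simpa using ht.1]

theorem computes_of_primrec' {n : ℕ} {f : List.Vector ℕ n → ℕ} (hf : Nat.Primrec' f) :
    Computes f := by
  induction hf with
  | zero => exact computes_zero
  | succ => exact computes_succ
  | get i => exact computes_get i
  | comp g _ _ hf hg => exact computes_comp g hf hg
  | prec _ _ hf hg => exact computes_prec hf hg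

theorem step_nil (s : ℕ → ℕ) : step ([], s) = ([], s) := rfl

theorem iterate_step_nil (n : ℕ) (s : ℕ → ℕ) : step^[n] ([], s) = ([], s) :=
  Function.iterate_fixed (step_nil s) n

/-- The unbounded search for a zero of a primitive recursive function. -/
theorem exists_search {g : ℕ → ℕ → ℕ} (hg : Primrec₂ g) :
    ∃ c : Cmd, ∀ m, c.machine.Halts m ↔ ∃ k, g m k = 0 := by
  obtain ⟨d, hd⟩ := computes_of_primrec' (Nat.Primrec'.prim_iff₂.2 hg) ![0, 1] 2 3
    (fun i => by fin_cases i <;> simp) (by omega) (fun i => by fin_cases i <;> simp)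
  refine ⟨seq d (loop 2 (seq (inc 1) d)), fun m => ?_⟩
  have hd' : ∀ s, ∃ t, Run d s t ∧ t 2 = g (s 0) (s 1) ∧ t 0 = s 0 ∧ t 1 = s 1 := fun s => by
    obtain ⟨t, h1, h2, h3⟩ := hd s
    exact ⟨t, h1, by simpa [List.Vector.ofFn] using h2, h3 0 (by omega) (by omega),
      h3 1 (by omega) (by omega)⟩
  have hstep : (machine (seq d (loop 2 (seq (inc 1) d)))).step = step := rfl
  unfold CounterMachine.Halts
  rw [hstep]
  change (∃ n, (step^[n] ([_], _)).1 = []) ↔ _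
  obtain ⟨t₀, hr, h2, h0, h1⟩ := hd' (Function.update 0 0 m)
  simp only [Function.update_self, ne_eq, one_ne_zero, not_false_eq_true,
    Function.update_of_ne, Pi.zero_apply] at h2 h0 h1
  have body : ∀ k t, t 0 = m → t 1 = k → t 2 = g m k →
      ∃ t', Run (seq (inc 1) d) t t' ∧ t' 0 = m ∧ t' 1 = k + 1 ∧ t' 2 = g m (k + 1) := by
    intro k t e0 e1 e2
    obtain ⟨t', r, a2, a0, a1⟩ := hd' (Function.update t 1 (t 1 + 1))
    have e : Function.update t 1 (t 1 + 1) 0 = m := by simp [e0]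
    rw [e, Function.update_self, e1] at a2
    exact ⟨t', (run_inc 1 t).seq r, by rw [a0, e], by rw [a1, Function.update_self, e1], a2⟩
  constructor
  · rintro ⟨N, hN⟩
    by_contra! hne
    -- Without a zero, the loop head is visited at arbitrarily late times. The halting continuation
    -- `[]` is a fixed point of `step`, so halting by time `N` would exclude this.
    have key : ∀ k, ∃ n t, k ≤ n ∧ step^[n] ([seq d (loop 2 (seq (inc 1) d))],
        Function.update 0 0 m) = ([loop 2 (seq (inc 1) d)], t) ∧ t 0 = m ∧ t 1 = k ∧
        t 2 = g m k := by
      intro k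
      induction k with
      | zero =>
        obtain ⟨n, hn⟩ := hr [loop 2 (seq (inc 1) d)]
        exact ⟨n + 1, t₀, by omega, by rw [Function.iterate_succ_apply]; exact hn, h0, h1, h2⟩
      | succ k ih =>
        obtain ⟨n, t, hkn, hn, e0, e1, e2⟩ := ih
        obtain ⟨t', hr', a0, a1, a2⟩ := body k t e0 e1 e2
        obtain ⟨l, hl⟩ := hr' [loop 2 (seq (inc 1) d)]
        refine ⟨l + (1 + n), t', by omega, ?_, a0, a1, a2⟩
        rw [Function.iterate_add_apply, Function.iterate_add_apply, hn, Function.iterate_one,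
          step_loop_pos (by rw [e2]; exact hne k), hl]
    obtain ⟨n, t, hn, e, -⟩ := key N
    obtain ⟨l, rfl⟩ := Nat.exists_eq_add_of_le hn
    rw [add_comm, Function.iterate_add_apply] at e
    rw [← Prod.mk.eta (p := step^[N] _), hN, iterate_step_nil] at e
    exact absurd (congrArg Prod.fst e) (by simp)
  · rintro ⟨k, hk⟩
    -- Induction on the distance `j` to a known zero; an earlier zero just ends the loop sooner.
    have key : ∀ j k t, t 0 = m → t 1 = k → t 2 = g m k → g m (k + j) = 0 →
        ∃ t', Run (loop 2 (seq (inc 1) d)) t t' := by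
      intro j
      induction j with
      | zero => exact fun k t _ _ e2 hz => ⟨t, run_loop_zero (by rw [e2]; exact hz)⟩
      | succ j ih =>
        intro k t e0 e1 e2 hz
        by_cases h : t 2 = 0
        · exact ⟨t, run_loop_zero h⟩
        · obtain ⟨t', hr', a0, a1, a2⟩ := body k t e0 e1 e2
          obtain ⟨t'', h''⟩ := ih (k + 1) t' a0 a1 a2 (by rw [← hz]; congr 1; omega)
          exact ⟨t'', run_loop_pos h hr' h''⟩
    obtain ⟨t', ht'⟩ := key k 0 t₀ h0 h1 h2 (by simpa using hk)
    obtain ⟨n, hn⟩ := (hr.seq ht') []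
    exact ⟨n, by rw [hn]⟩

end Cmd

/-! ### A finite-state machine with undecidable halting problem -/

/-- The restriction of a machine to a set of states that is closed under its transitions. -/
def CounterMachine.restrict {σ : Type} (M : CounterMachine σ) (A : Set σ) (hs : M.start ∈ A)
    (hh : M.halt ∈ A) (hn : ∀ q ∈ A, ∀ z, M.next q z ∈ A) : CounterMachine A where
  start := ⟨M.start, hs⟩
  halt := ⟨M.halt, hh⟩
  test q := M.test q
  act q := M.act q
  next q z := ⟨M.next q z, hn q q.2 z⟩
  guarded q z i h := M.guarded q z i h

theorem CounterMachine.halts_restrict_iff {σ : Type} (M : CounterMachine σ) (A : Set σ)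
    (hs : M.start ∈ A) (hh : M.halt ∈ A) (hn : ∀ q ∈ A, ∀ z, M.next q z ∈ A) (m : ℕ) :
    (M.restrict A hs hh hn).Halts m ↔ M.Halts m := by
  have key : ∀ n s, (fun c : A × (ℕ → ℕ) => ((c.1 : σ), c.2))
      ((M.restrict A hs hh hn).step^[n] s) = M.step^[n] (s.1, s.2) := fun n s => by
    have : Function.Semiconj (fun c : A × (ℕ → ℕ) => ((c.1 : σ), c.2))
      (M.restrict A hs hh hn).step M.step := fun _ => rfl
    exact this.iterate_right n s
  unfold Halts
  refine exists_congr fun n => ?_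
  rw [Subtype.ext_iff]
  exact iff_of_eq (congrArg (· = M.halt) (congrArg Prod.fst (key n _)))

/-- There is a counter machine with finitely many states and an undecidable halting problem. -/
theorem exists_undecidable_counterMachine :
    ∃ (σ : Type) (_ : Finite σ) (M : CounterMachine σ), ¬ ComputablePred M.Halts := by
  -- The step-bounded evaluator is primitive recursive, and code `m` halts on input `0` iff some
  -- bound `k` makes this function vanish.
  have hg : Primrec₂ fun m k : ℕ =>
      bif (Nat.Partrec.Code.evaln k (Denumerable.ofNat Nat.Partrec.Code m) 0).isSome
        then 0 else 1 := by
    refine Primrec.cond (Primrec.option_isSome.comp ?_) (Primrec.const 0) (Primrec.const 1)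
    exact Nat.Partrec.Code.primrec_evaln.comp ((Primrec.snd.pair
      ((Primrec.ofNat _).comp Primrec.fst)).pair (Primrec.const 0))
  obtain ⟨c, hc⟩ := Cmd.exists_search hg
  have hfin : (insert [] (Cmd.continuations c [])).Finite := (Cmd.finite_continuations c []).insert _
  refine ⟨_, hfin, c.machine.restrict _ (Or.inr (Cmd.cons_mem_continuations c [])) (Or.inl rfl)
    ?_, fun h => ?_⟩
  · rintro q (rfl | hq) z
    · exact Or.inl rfl
    · exact Cmd.next_mem_continuations c [] q z hq
  · refine ComputablePred.halting_problem 0 (ComputablePred.computable_of_manyOneReducible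
      ⟨Encodable.encode, Computable.encode, fun d => ?_⟩ h)
    refine Iff.trans ?_ ((CounterMachine.halts_restrict_iff _ _ _ _ _ _).trans (hc _)).symm
    simp only [Denumerable.ofNat_encode, Part.dom_iff_mem, Nat.Partrec.Code.evaln_complete]
    constructor
    · rintro ⟨y, k, h⟩
      exact ⟨k, by rw [Option.mem_def] at h; simp [h]⟩
    · rintro ⟨k, h⟩
      cases h' : Nat.Partrec.Code.evaln k d 0 with
      | none => simp [h'] at h
      | some y => exact ⟨y, k, h'⟩

/-! ### Derived connectives and their truth conditions -/

namespace Modal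

open Formula

namespace Formula

variable {ι : Type}

def top : Formula ι := neg (and (var 0) (neg (var 0)))

def conj : List (Formula ι) → Formula ι
  | [] => top
  | φ :: l => and φ (conj l)

def iff (φ ψ : Formula ι) : Formula ι := and (imp φ ψ) (imp ψ φ)

/-- `φ` holds at the given point or at some other point of its column. -/
def rowDia (φ : BimodalFormula) : BimodalFormula := neg (and (neg φ) (neg (dia 1 φ)))

/-- `φ` holds at the given point and at all other points of its column. -/
def rowBox (φ : BimodalFormula) : BimodalFormula := and φ (box 1 φ)

/-- There is a chain of `n` steps along the first relation. -/
def chain : ℕ → BimodalFormula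
  | 0 => top
  | n + 1 => dia 0 (chain n)

end Formula

section Truth

variable {ι : Type} {F : Frame.{u} ι} {ν : ℕ → Set F.W} {w : F.W} {φ ψ : Formula ι}

@[simp] theorem truth_var {n : ℕ} : Truth F ν w (var n) ↔ w ∈ ν n := Iff.rfl

@[simp] theorem truth_neg : Truth F ν w (neg φ) ↔ ¬ Truth F ν w φ := Iff.rfl

@[simp] theorem truth_and : Truth F ν w (and φ ψ) ↔ Truth F ν w φ ∧ Truth F ν w ψ := Iff.rfl

@[simp] theorem truth_dia {i : ι} : Truth F ν w (dia i φ) ↔ ∃ v, F.R i w v ∧ Truth F ν v φ :=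
  Iff.rfl

@[simp] theorem truth_imp : Truth F ν w (imp φ ψ) ↔ (Truth F ν w φ → Truth F ν w ψ) := by
  simp [imp]

@[simp] theorem truth_box {i : ι} : Truth F ν w (box i φ) ↔ ∀ v, F.R i w v → Truth F ν v φ := by
  simp [box]

@[simp] theorem truth_top : Truth F ν w top := by simp [top]

@[simp] theorem truth_iff : Truth F ν w (iff φ ψ) ↔ (Truth F ν w φ ↔ Truth F ν w ψ) := by
  simp [iff, iff_def]

@[simp] theorem truth_conj {l : List (Formula ι)} :
    Truth F ν w (conj l) ↔ ∀ φ ∈ l, Truth F ν w φ := by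
  induction l with
  | nil => simp [conj]
  | cons φ l ih => simp [conj, ih]

end Truth

/-! ### Rows, depth and counting in commutator frames -/

/-- The first-order conditions on bimodal frames that correspond to the axioms of
`[K4.3, Diff]`. -/
structure Frame.IsCommutatorFrame (F : Frame.{u} (Fin 2)) : Prop where
  trans : ∀ x y z, F.R 0 x y → F.R 0 y z → F.R 0 x z
  linear : ∀ x y z, F.R 0 x y → F.R 0 x z → F.R 0 y z ∨ y = z ∨ F.R 0 z y
  symm : ∀ x y, F.R 1 x y → F.R 1 y x
  ptrans : ∀ x y z, F.R 1 x y → F.R 1 y z → x = z ∨ F.R 1 x z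
  comm₀₁ : ∀ x y z, F.R 0 x y → F.R 1 y z → ∃ u, F.R 1 x u ∧ F.R 0 u z
  comm₁₀ : ∀ x y z, F.R 1 x y → F.R 0 y z → ∃ u, F.R 0 x u ∧ F.R 1 u z

namespace Frame

variable (F : Frame.{u} (Fin 2))

/-- `x` and `y` are equal or related by the second relation. -/
def Row (x y : F.W) : Prop := x = y ∨ F.R 1 x y

/-- There is a chain of length `n` along the first relation that starts at `x`. -/
def HasChain : ℕ → F.W → Prop
  | 0, _ => True
  | n + 1, x => ∃ y, F.R 0 x y ∧ HasChain n y

/-- The longest chain along the first relation that starts at `x` has length `n`. -/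
def HasDepth (n : ℕ) (x : F.W) : Prop := F.HasChain n x ∧ ¬ F.HasChain (n + 1) x

/-- The points below the row of `r`. -/
def Under (r x : F.W) : Prop := ∃ z, F.Row r z ∧ F.R 0 z x

variable {F}

theorem HasChain.of_succ {n : ℕ} {x : F.W} (h : F.HasChain (n + 1) x) : F.HasChain n x := by
  induction n generalizing x with
  | zero => trivial
  | succ n ih =>
    obtain ⟨y, hy, h⟩ := h
    exact ⟨y, hy, ih h⟩

theorem HasChain.of_le {n k : ℕ} {x : F.W} (h : F.HasChain n x) (hk : k ≤ n) : F.HasChain k x := by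
  induction hk with
  | refl => exact h
  | step _ ih => exact ih h.of_succ

theorem HasDepth.hasChain_iff {n k : ℕ} {x : F.W} (h : F.HasDepth n x) :
    F.HasChain k x ↔ k ≤ n := by
  refine ⟨fun hk => ?_, h.1.of_le⟩
  by_contra! hn
  exact h.2 (hk.of_le hn)

@[simp] theorem _root_.Modal.truth_chain {ν : ℕ → Set F.W} {w : F.W} {n : ℕ} :
    Truth F ν w (chain n) ↔ F.HasChain n w := by
  induction n generalizing w with
  | zero => simp [chain, HasChain]
  | succ n ih => simp [chain, HasChain, ih]

@[simp] theorem _root_.Modal.truth_rowDia {ν : ℕ → Set F.W} {w : F.W} {φ : BimodalFormula} :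
    Truth F ν w (rowDia φ) ↔ ∃ v, F.Row w v ∧ Truth F ν v φ := by
  simp only [rowDia, truth_neg, truth_and, truth_dia, Row]
  constructor
  · intro h
    by_contra! hn
    exact h ⟨hn w (Or.inl rfl), fun ⟨v, hv, h⟩ => hn v (Or.inr hv) h⟩
  · rintro ⟨v, rfl | hv, h⟩ ⟨h1, h2⟩
    · exact h1 h
    · exact h2 ⟨v, hv, h⟩

@[simp] theorem _root_.Modal.truth_rowBox {ν : ℕ → Set F.W} {w : F.W} {φ : BimodalFormula} :
    Truth F ν w (rowBox φ) ↔ ∀ v, F.Row w v → Truth F ν v φ := by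
  simp only [rowBox, truth_and, truth_box, Row]
  constructor
  · rintro ⟨h, h'⟩ v (rfl | hv)
    exacts [h, h' v hv]
  · exact fun h => ⟨h w (Or.inl rfl), fun v hv => h v (Or.inr hv)⟩

namespace IsCommutatorFrame

variable (hF : F.IsCommutatorFrame)

include hF

theorem row_symm {x y : F.W} (h : F.Row x y) : F.Row y x := by
  rcases h with rfl | h
  exacts [Or.inl rfl, Or.inr (hF.symm _ _ h)]

theorem row_trans {x y z : F.W} (h : F.Row x y) (h' : F.Row y z) : F.Row x z := by
  rcases h with rfl | h
  · exact h'
  · rcases h' with rfl | h'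
    exacts [Or.inr h, hF.ptrans _ _ _ h h']

theorem row_comm₀₁ {x y z : F.W} (h : F.R 0 x y) (h' : F.Row y z) :
    ∃ u, F.Row x u ∧ F.R 0 u z := by
  rcases h' with rfl | h'
  · exact ⟨x, Or.inl rfl, h⟩
  · obtain ⟨u, h1, h2⟩ := hF.comm₀₁ _ _ _ h h'
    exact ⟨u, Or.inr h1, h2⟩

theorem row_comm₁₀ {x y z : F.W} (h : F.Row x y) (h' : F.R 0 y z) :
    ∃ u, F.R 0 x u ∧ F.Row u z := by
  rcases h with rfl | h
  · exact ⟨z, h', Or.inl rfl⟩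
  · obtain ⟨u, h1, h2⟩ := hF.comm₁₀ _ _ _ h h'
    exact ⟨u, h1, Or.inr h2⟩

/-- Commutation transports a chain along a row one step at a time. Hence depth is constant on rows
and can serve as time. -/
theorem hasChain_row {n : ℕ} {x y : F.W} (h : F.Row x y) (hx : F.HasChain n x) :
    F.HasChain n y := by
  induction n generalizing x y with
  | zero => trivial
  | succ n ih =>
    obtain ⟨z, hz, hc⟩ := hx
    obtain ⟨u, hu, hr⟩ := hF.row_comm₁₀ (hF.row_symm h) hz
    exact ⟨u, hu, ih (hF.row_symm hr) hc⟩

theorem hasDepth_row {n : ℕ} {x y : F.W} (h : F.Row x y) (hx : F.HasDepth n x) :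
    F.HasDepth n y :=
  ⟨hF.hasChain_row h hx.1, fun hc => hx.2 (hF.hasChain_row (hF.row_symm h) hc)⟩

/-- Successors of one point are comparable, and strictly related points cannot both have depth `n`.
So a column below `z` meets each time at most once. -/
theorem eq_of_hasDepth {n : ℕ} {z u v : F.W} (hu : F.R 0 z u) (hv : F.R 0 z v)
    (hun : F.HasDepth n u) (hvn : F.HasDepth n v) : u = v := by
  rcases hF.linear _ _ _ hu hv with h | h | h
  · exact absurd ⟨v, h, hvn.1⟩ hun.2
  · exact h
  · exact absurd ⟨u, h, hun.1⟩ hvn.2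

/-- Columns do not split above a point that is irreflexive with respect to the second relation. -/
theorem reflexive_of_common_succ {n : ℕ} {y y' u : F.W} (hy : F.R 1 y y') (hu : F.R 0 y u)
    (hu' : F.R 0 y' u) (hun : F.HasDepth n u) : F.R 1 u u := by
  obtain ⟨v, hv, hvu⟩ := hF.comm₁₀ _ _ _ hy hu'
  -- The row partner `v` of `u` below `y` has the same depth as `u`, so it is `u` itself.
  have : v = u := hF.eq_of_hasDepth hv hu
    (hF.hasDepth_row (hF.row_symm (Or.inr hvu)) hun) hun
  exact this ▸ hvu

theorem under_row {r x y : F.W} (hx : F.Under r x) (h : F.Row x y) : F.Under r y := by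
  obtain ⟨z, hz, hzx⟩ := hx
  obtain ⟨u, hu, huy⟩ := hF.row_comm₀₁ hzx h
  exact ⟨u, hF.row_trans hz hu, huy⟩

theorem under_trans {r x y : F.W} (hx : F.Under r x) (h : F.R 0 x y) : F.Under r y := by
  obtain ⟨z, hz, hzx⟩ := hx
  exact ⟨z, hz, hF.trans _ _ _ hzx h⟩

end IsCommutatorFrame

/-- The row of `x` has exactly `k` points in `X`, all of them irreflexive. -/
def Counts (x : F.W) (X : Set F.W) (k : ℕ) : Prop :=
  {y | F.Row x y ∧ y ∈ X}.Finite ∧ {y | F.Row x y ∧ y ∈ X}.ncard = k ∧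
    ∀ y, F.Row x y → y ∈ X → ¬ F.R 1 y y

theorem IsCommutatorFrame.counts_row (hF : F.IsCommutatorFrame) {x y : F.W} (h : F.Row x y)
    {X : Set F.W} {k : ℕ} (hx : Counts x X k) : Counts y X k := by
  have : ∀ z, F.Row y z ↔ F.Row x z := fun z =>
    ⟨hF.row_trans h, hF.row_trans (hF.row_symm h)⟩
  simpa only [Counts, this] using hx

/-- The points of `X` in the next row that are not new correspond to the points of `X`. -/
theorem IsCommutatorFrame.counts_old (hF : F.IsCommutatorFrame) {n k : ℕ} {r s x : F.W}
    {X : Set F.W} (hs : F.Under r s) (hxs : F.R 0 s x) (hx : F.HasDepth n x)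
    (hsn : F.HasDepth (n + 1) s) (hX : ∀ y u, F.Under r y → F.R 0 y u → u ∈ X → y ∈ X)
    (hc : Counts x X k) : Counts s {y | ∃ u, F.R 0 y u ∧ u ∈ X} k := by
  have hup : ∀ u, F.Row x u → ∃ y, F.Row s y ∧ F.R 0 y u := fun u hu => hF.row_comm₀₁ hxs hu
  have hdown : ∀ y, F.Row s y → (∃ u, F.R 0 y u ∧ u ∈ X) →
      ∃ p, F.R 0 y p ∧ F.Row x p ∧ p ∈ X := by
    rintro y hy ⟨u, hu, huX⟩
    obtain ⟨p, hp, hpx⟩ := hF.row_comm₁₀ (hF.row_symm hy) hxs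
    have hpn := hF.hasDepth_row (hF.row_symm hpx) hx
    refine ⟨p, hp, hF.row_symm hpx, ?_⟩
    rcases hF.linear _ _ _ hp hu with h | rfl | h
    · exact hX p u (hF.under_trans (hF.under_row hs hy) hp) h huX
    · exact huX
    · exact absurd ⟨u, hu, p, h, hpn.1⟩ (hF.hasDepth_row hy hsn).2
  choose! g hg using hup
  obtain ⟨h1, h2, h3⟩ := hc
  -- The map `g` lifts a point one row up. It is onto the old points because `y` and `g p` share the
  -- successor `p`: were they related by the second relation, `p` would be reflexive.
  have himage : {y | F.Row s y ∧ y ∈ {y | ∃ u, F.R 0 y u ∧ u ∈ X}} =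
      g '' {y | F.Row x y ∧ y ∈ X} := by
    ext y
    constructor
    · rintro ⟨hy, hyu⟩
      obtain ⟨p, hp, hpx, hpX⟩ := hdown y hy hyu
      refine ⟨p, ⟨hpx, hpX⟩, ?_⟩
      rcases hF.row_trans (hF.row_symm (hg p hpx).1) hy with h | h
      · exact h
      · exact absurd (hF.reflexive_of_common_succ h (hg p hpx).2 hp (hF.hasDepth_row hpx hx))
          (h3 p hpx hpX)
    · rintro ⟨u, ⟨hu, huX⟩, rfl⟩
      exact ⟨(hg u hu).1, u, (hg u hu).2, huX⟩
  have hinj : Set.InjOn g {y | F.Row x y ∧ y ∈ X} := by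
    rintro u ⟨hu, -⟩ v ⟨hv, -⟩ huv
    exact hF.eq_of_hasDepth (hg u hu).2 (huv ▸ (hg v hv).2) (hF.hasDepth_row hu hx)
      (hF.hasDepth_row hv hx)
  refine ⟨himage ▸ h1.image g, by rw [himage, hinj.ncard_image, h2], ?_⟩
  intro y hy hyu hrefl
  obtain ⟨p, hp, hpx, hpX⟩ := hdown y hy hyu
  exact h3 p hpx hpX (hF.reflexive_of_common_succ hrefl hp hp (hF.hasDepth_row hpx hx))

/-- If nothing is acquired, every point of `X` in the row of `s` is old; the converse inclusion is
persistence `hX`. -/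
theorem IsCommutatorFrame.counts_fixed (hF : F.IsCommutatorFrame) {n k : ℕ} {r s x : F.W}
    {X : Set F.W} (hs : F.Under r s) (hxs : F.R 0 s x) (hx : F.HasDepth n x)
    (hsn : F.HasDepth (n + 1) s) (hX : ∀ y u, F.Under r y → F.R 0 y u → u ∈ X → y ∈ X)
    (hc : Counts x X k) (h : ∀ y, F.Row s y → y ∈ X → ∃ u, F.R 0 y u ∧ u ∈ X) :
    Counts s X k := by
  have hold := hF.counts_old hs hxs hx hsn hX hc
  have : ∀ y, F.Row s y → ((∃ u, F.R 0 y u ∧ u ∈ X) ↔ y ∈ X) := fun y hy =>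
    ⟨fun ⟨u, hu, huX⟩ => hX y u (hF.under_row hs hy) hu huX, h y hy⟩
  have hset : {y | F.Row s y ∧ y ∈ {y | ∃ u, F.R 0 y u ∧ u ∈ X}} = {y | F.Row s y ∧ y ∈ X} := by
    ext y
    exact and_congr_right (this y)
  rw [Counts, hset] at hold
  exact ⟨hold.1, hold.2.1, fun y hy hyX => hold.2.2 y hy ((this y hy).2 hyX)⟩

/-- The row of `s` consists, within `X`, of the old points and the single new point `y₀`. -/
theorem IsCommutatorFrame.counts_changed (hF : F.IsCommutatorFrame) {n k : ℕ} {r s x y₀ : F.W}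
    {X : Set F.W} (hs : F.Under r s) (hxs : F.R 0 s x) (hx : F.HasDepth n x)
    (hsn : F.HasDepth (n + 1) s) (hX : ∀ y u, F.Under r y → F.R 0 y u → u ∈ X → y ∈ X)
    (hc : Counts x X k) (hy₀ : F.Row s y₀) (hy₀X : y₀ ∈ X) (hnew : ∀ u, F.R 0 y₀ u → u ∉ X)
    (h : ∀ y, F.R 1 y₀ y → y ∈ X → ∃ u, F.R 0 y u ∧ u ∈ X) :
    Counts s X (k + 1) := by
  have hold := hF.counts_old hs hxs hx hsn hX hc
  have hset : {y | F.Row s y ∧ y ∈ X} =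
      insert y₀ {y | F.Row s y ∧ y ∈ {y | ∃ u, F.R 0 y u ∧ u ∈ X}} := by
    ext y
    constructor
    · rintro ⟨hy, hyX⟩
      rcases hF.row_trans (hF.row_symm hy₀) hy with rfl | h'
      · exact Or.inl rfl
      · exact Or.inr ⟨hy, h y h' hyX⟩
    · rintro (rfl | ⟨hy, u, hu, huX⟩)
      · exact ⟨hy₀, hy₀X⟩
      · exact ⟨hy, hX y u (hF.under_row hs hy) hu huX⟩
  have hnot : y₀ ∉ {y | F.Row s y ∧ y ∈ {y | ∃ u, F.R 0 y u ∧ u ∈ X}} := by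
    rintro ⟨-, u, hu, huX⟩
    exact hnew u hu huX
  refine ⟨hset ▸ hold.1.insert _, by rw [hset, Set.ncard_insert_of_notMem hnot hold.1, hold.2.1],
    fun y hy hyX hrefl => ?_⟩
  -- The new point is irreflexive too: if it were related to itself, `h` would apply to it and make
  -- it old.
  by_cases hyu : ∃ u, F.R 0 y u ∧ u ∈ X
  · exact hold.2.2 y hy hyu hrefl
  · rcases hF.row_trans (hF.row_symm hy₀) hy with rfl | h'
    · exact hyu (h _ hrefl hyX)
    · exact hyu (h _ h' hyX)

end Frame

end Modal

/-! ### Runs with a loading phase and the formulas that describe them -/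

namespace CounterMachine

variable {σ : Type} (M : CounterMachine σ)

/-- The run on input `m`, preceded by `m` steps that load the input into counter `0`. -/
def run (m : ℕ) : ℕ → σ × (ℕ → ℕ)
  | 0 => (M.start, 0)
  | n + 1 => if n < m then (M.start, updateCounters (some (0, true)) (run m n).2)
      else M.step (run m n)

/-- The outcome of the zero test at time `n`. -/
def runTest (m n : ℕ) : Bool := decide ((M.run m n).2 (M.test (M.run m n).1) = 0)

/-- The action at time `n`. -/
def runAct (m n : ℕ) : Option (ℕ × Bool) :=
  if n < m then some (0, true) else M.act (M.run m n).1 (M.runTest m n)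

theorem run_succ_snd (m n : ℕ) :
    (M.run m (n + 1)).2 = updateCounters (M.runAct m n) (M.run m n).2 := by
  rw [run, runAct]
  split_ifs <;> rfl

theorem run_succ_fst_of_lt {m n : ℕ} (h : n < m) : (M.run m (n + 1)).1 = M.start := by
  rw [run, if_pos h]

theorem run_succ_fst_of_le {m n : ℕ} (h : m ≤ n) :
    (M.run m (n + 1)).1 = M.next (M.run m n).1 (M.runTest m n) := by
  rw [run, if_neg (by omega)]
  rfl

/-- Here the guard pays off: subtraction is never truncated in a run, so counters remain exact
differences of added and removed elements. -/
theorem runAct_dec {m n i : ℕ} (h : M.runAct m n = some (i, false)) : (M.run m n).2 i ≠ 0 := by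
  rw [runAct] at h
  split_ifs at h with hn
  · simp at h
  · obtain ⟨rfl, hz⟩ := M.guarded _ _ _ h
    simpa [runTest] using hz

theorem run_of_le {m n : ℕ} (h : n ≤ m) : M.run m n = (M.start, Function.update (0 : ℕ → ℕ) 0 n) := by
  induction n with
  | zero => simp only [run]; congr 1; ext i; by_cases hi : i = 0 <;> simp [hi]
  | succ n ih =>
    rw [run, if_pos (by omega), ih (by omega)]
    simp [updateCounters]

theorem run_add (m n : ℕ) :
    M.run m (m + n) = M.step^[n] (M.start, Function.update (0 : ℕ → ℕ) 0 m) := by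
  induction n with
  | zero => exact M.run_of_le le_rfl
  | succ n ih =>
    rw [← add_assoc, run, if_neg (by omega), ih, Function.iterate_succ_apply']

theorem halts_iff (m : ℕ) : M.Halts m ↔ ∃ n, (M.run m n).1 = M.halt := by
  constructor
  · rintro ⟨n, hn⟩
    exact ⟨m + n, by rw [run_add, hn]⟩
  · rintro ⟨n, hn⟩
    by_cases h : n ≤ m
    · rw [run_of_le M h] at hn
      exact ⟨0, hn⟩
    · obtain ⟨k, rfl⟩ := Nat.exists_eq_add_of_le (not_le.1 h).le
      exact ⟨k, by rw [← run_add, hn]⟩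

/-- All counters that the machine tests have an index below `K`. -/
def TestsBelow (K : ℕ) : Prop := ∀ q, M.test q < K

theorem exists_testsBelow [Finite σ] : ∃ K, M.TestsBelow K := by
  obtain ⟨a, ha⟩ := (Set.finite_range M.test).bddAbove
  exact ⟨a + 1, fun q => Nat.lt_succ_of_le (ha ⟨q, rfl⟩)⟩

/-- The propositional variables that describe a run: `diag` marks the diagonal and `above` the
points just above it, `loaded` the times after the loading phase, `state q` the times in state `q`,
and `token (i, true)` (`token (i, false)`) the elements that have been added to (removed from)
counter `i`. -/
inductive Label (σ : Type) : Type
  | diag | above | loaded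
  | state : σ → Label σ
  | token : ℕ × Bool → Label σ

/-- The indices of the propositional variables, given a numbering of the states. -/
def Label.index (e : σ → ℕ) : Label σ → ℕ
  | diag => 0
  | above => 1
  | loaded => 2
  | state q => 3 * e q + 3
  | token (i, true) => 3 * i + 4
  | token (i, false) => 3 * i + 5

theorem Label.index_injective {e : σ → ℕ} (he : Function.Injective e) :
    Function.Injective (Label.index e) := by
  rintro (_ | _ | _ | q | ⟨i, _ | _⟩) (_ | _ | _ | q' | ⟨i', _ | _⟩) h <;>
    simp only [Label.index] at h <;> first | rfl | (exfalso; omega) | skip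
  · rw [he (show e q = e q' by omega)]
  · rw [show i = i' by omega]
  · rw [show i = i' by omega]

def tokens (K : ℕ) : List (ℕ × Bool) := (List.range K).product [true, false]

theorem mem_tokens {K i : ℕ} {b : Bool} : (i, b) ∈ tokens K ↔ i < K := by
  simp [tokens]

open Formula

section Formulas

variable (e : σ → ℕ)

def labelVar (l : Label σ) : BimodalFormula := var (l.index e)

/-- The token is acquired at the given point. -/
def newToken (t : ℕ × Bool) : BimodalFormula :=
  and (labelVar e (.token t)) (box 0 (neg (labelVar e (.token t))))

/-- No point of the row acquires the token. -/
def tokenFixed (t : ℕ × Bool) : BimodalFormula := rowBox (neg (newToken e t))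

/-- Exactly one point of the row acquires the token. -/
def tokenChanged (t : ℕ × Bool) : BimodalFormula :=
  rowDia (and (newToken e t) (neg (dia 1 (newToken e t))))

open Classical in
/-- The acquired tokens are those of the action `a`. -/
def effect (K : ℕ) (a : Option (ℕ × Bool)) : BimodalFormula :=
  conj ((tokens K).map fun t => if a = some t then tokenChanged e t else tokenFixed e t)

/-- Since removed elements are among the added ones by `tokenFormula`, an unremoved element exists
iff the two finite counts differ. -/
def nonzero (i : ℕ) : BimodalFormula :=
  rowDia (and (labelVar e (.token (i, true))) (neg (labelVar e (.token (i, false)))))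

def zeroTest (i : ℕ) : Bool → BimodalFormula
  | true => neg (nonzero e i)
  | false => nonzero e i

def initialFormula (K : ℕ) : BimodalFormula :=
  and (labelVar e .diag) (and (box 0 (neg top)) (and (labelVar e (.state M.start))
    (conj ((tokens K).map fun t => rowBox (neg (labelVar e (.token t)))))))

/-- `above` points have a `diag` point as immediate successor, and one in their row. -/
def ladderFormula : BimodalFormula :=
  and (imp (labelVar e .diag) (box 0 (neg (labelVar e .diag))))
    (imp (labelVar e .above) (and (dia 0 (labelVar e .diag))
      (and (box 0 (neg (and (neg (labelVar e .diag)) (dia 0 (labelVar e .diag)))))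
        (rowDia (labelVar e .diag)))))

/-- Persistence of marks and containment of removals in additions; decrementing never deletes a
mark. -/
def tokenFormula (K : ℕ) : BimodalFormula :=
  and (conj ((tokens K).map fun t =>
      imp (dia 0 (labelVar e (.token t))) (labelVar e (.token t))))
    (conj ((List.range K).map fun i =>
      imp (labelVar e (.token (i, false))) (labelVar e (.token (i, true)))))

/-- The input enters only through the meaning of `loaded`, fixed in `reduction`, so this formula is
the same for all `m`. -/
def loadFormula (K : ℕ) : BimodalFormula :=
  imp (and (labelVar e .above) (neg (labelVar e .loaded)))
    (and (effect e K (some (0, true))) (rowBox (labelVar e (.state M.start))))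

/-- The diagonal point seen from an `above` point lies exactly one row down, which replaces a
previous-time operator. -/
def transitionFormula (K : ℕ) (q : σ) (z : Bool) : BimodalFormula :=
  imp (and (labelVar e .above) (and (labelVar e .loaded)
      (dia 0 (and (labelVar e .diag) (and (labelVar e (.state q)) (zeroTest e (M.test q) z))))))
    (and (effect e K (M.act q z)) (rowBox (labelVar e (.state (M.next q z)))))

variable [Fintype σ]

noncomputable def ruleFormula (K : ℕ) : BimodalFormula :=
  conj [ladderFormula e, tokenFormula e K, M.loadFormula e K,
    conj ((Finset.univ.toList : List σ).map fun q =>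
      and (M.transitionFormula e K q true) (M.transitionFormula e K q false)),
    neg (labelVar e (.state M.halt))]

/-- Meant for a limit row over all times, the row of `ω` in the grid. Every column below it must
have a rung of the ladder, so the ladder never stops. -/
noncomputable def runFormula (K : ℕ) : BimodalFormula :=
  and (rowDia (dia 0 (M.initialFormula e K)))
    (and (rowBox (dia 0 (labelVar e .above))) (rowBox (box 0 (M.ruleFormula e K))))

/-- The formula that is satisfiable iff the machine does not halt on input `m`. -/
noncomputable def reduction (K m : ℕ) : BimodalFormula :=
  and (M.runFormula e K) (rowBox (box 0 (iff (labelVar e .loaded) (chain (m + 1)))))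

end Formulas

/-! ### From a model on a commutator frame to a non-halting run -/

section Semantics

variable {F : Frame.{u} (Fin 2)} {ν : ℕ → Set F.W} {w : F.W} {e : σ → ℕ} {K : ℕ}

@[simp] theorem truth_labelVar {l : Label σ} :
    Truth F ν w (labelVar e l) ↔ w ∈ ν (l.index e) := Iff.rfl

theorem truth_conj_tokens {f : ℕ × Bool → BimodalFormula} :
    Truth F ν w (conj ((tokens K).map f)) ↔ ∀ t : ℕ × Bool, t.1 < K → Truth F ν w (f t) := by
  rw [truth_conj, List.forall_mem_map]
  exact forall_congr' fun t => imp_congr_left mem_tokens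

theorem truth_newToken {t : ℕ × Bool} : Truth F ν w (newToken e t) ↔
    w ∈ ν (Label.index e (.token t)) ∧ ∀ u, F.R 0 w u → u ∉ ν (Label.index e (.token t)) := by
  simp [newToken]

theorem truth_tokenFixed {t : ℕ × Bool} : Truth F ν w (tokenFixed e t) ↔
    ∀ y, F.Row w y → ¬ Truth F ν y (newToken e t) := by
  simp [tokenFixed]

theorem truth_tokenChanged {t : ℕ × Bool} : Truth F ν w (tokenChanged e t) ↔
    ∃ y, F.Row w y ∧ Truth F ν y (newToken e t) ∧
      ∀ y', F.R 1 y y' → ¬ Truth F ν y' (newToken e t) := by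
  simp [tokenChanged]

theorem truth_effect {a : Option (ℕ × Bool)} : Truth F ν w (effect e K a) ↔
    ∀ t, t.1 < K → (a = some t → Truth F ν w (tokenChanged e t)) ∧
      (a ≠ some t → Truth F ν w (tokenFixed e t)) := by
  classical
  rw [effect, truth_conj_tokens]
  refine forall_congr' fun t => imp_congr_right fun _ => ?_
  split_ifs with ha <;> simp [ha]

theorem truth_nonzero {i : ℕ} : Truth F ν w (nonzero e i) ↔
    ∃ y, F.Row w y ∧ y ∈ ν (Label.index e (.token (i, true))) ∧
      y ∉ ν (Label.index e (.token (i, false))) := by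
  simp [nonzero]

theorem truth_initialFormula : Truth F ν w (M.initialFormula e K) ↔
    w ∈ ν (Label.index e .diag) ∧ (∀ u, ¬ F.R 0 w u) ∧ w ∈ ν (Label.index e (.state M.start)) ∧
      ∀ t : ℕ × Bool, t.1 < K → ∀ y, F.Row w y → y ∉ ν (Label.index e (.token t)) := by
  simp only [initialFormula, truth_and, truth_conj_tokens, truth_labelVar, truth_box, truth_neg,
    truth_top, truth_rowBox, not_true_eq_false, imp_false]

theorem truth_ladderFormula : Truth F ν w (ladderFormula e) ↔
    (w ∈ ν (Label.index e .diag) → ∀ u, F.R 0 w u → u ∉ ν (Label.index e .diag)) ∧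
    (w ∈ ν (Label.index e .above) → (∃ u, F.R 0 w u ∧ u ∈ ν (Label.index e .diag)) ∧
      (∀ u, F.R 0 w u → u ∉ ν (Label.index e .diag) →
        ∀ u', F.R 0 u u' → u' ∉ ν (Label.index e .diag)) ∧
      ∃ y, F.Row w y ∧ y ∈ ν (Label.index e .diag)) := by
  simp [ladderFormula]

theorem truth_tokenFormula : Truth F ν w (tokenFormula e K) ↔
    (∀ t : ℕ × Bool, t.1 < K → ∀ u, F.R 0 w u → u ∈ ν (Label.index e (.token t)) →
      w ∈ ν (Label.index e (.token t))) ∧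
    ∀ i < K, w ∈ ν (Label.index e (.token (i, false))) →
      w ∈ ν (Label.index e (.token (i, true))) := by
  rw [tokenFormula, truth_and, truth_conj_tokens]
  simp only [truth_labelVar, truth_dia, truth_imp,
    truth_conj, List.forall_mem_map, List.mem_range, forall_exists_index, and_imp]

theorem truth_loadFormula : Truth F ν w (M.loadFormula e K) ↔
    (w ∈ ν (Label.index e .above) → w ∉ ν (Label.index e .loaded) →
      Truth F ν w (effect e K (some (0, true))) ∧
        ∀ y, F.Row w y → y ∈ ν (Label.index e (.state M.start))) := by
  simp [loadFormula]

theorem truth_transitionFormula {q : σ} {z : Bool} :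
    Truth F ν w (M.transitionFormula e K q z) ↔
    (w ∈ ν (Label.index e .above) → w ∈ ν (Label.index e .loaded) →
      ∀ x, F.R 0 w x → x ∈ ν (Label.index e .diag) → x ∈ ν (Label.index e (.state q)) →
      Truth F ν x (zeroTest e (M.test q) z) →
      Truth F ν w (effect e K (M.act q z)) ∧
        ∀ y, F.Row w y → y ∈ ν (Label.index e (.state (M.next q z)))) := by
  simp [transitionFormula]

theorem truth_ruleFormula [Fintype σ] : Truth F ν w (M.ruleFormula e K) ↔
    Truth F ν w (ladderFormula e) ∧ Truth F ν w (tokenFormula e K) ∧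
    Truth F ν w (M.loadFormula e K) ∧ (∀ q z, Truth F ν w (M.transitionFormula e K q z)) ∧
    w ∉ ν (Label.index e (.state M.halt)) := by
  simp [ruleFormula, Bool.forall_bool, and_comm]

theorem truth_reduction [Fintype σ] {m : ℕ} : Truth F ν w (M.reduction e K m) ↔
    (∃ z, F.Row w z ∧ ∃ x, F.R 0 z x ∧ Truth F ν x (M.initialFormula e K)) ∧
    (∀ z, F.Row w z → ∃ s, F.R 0 z s ∧ s ∈ ν (Label.index e .above)) ∧
    ∀ x, F.Under w x → Truth F ν x (M.ruleFormula e K) ∧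
      (x ∈ ν (Label.index e .loaded) ↔ F.HasChain (m + 1) x) := by
  simp only [reduction, runFormula, truth_and, truth_rowDia, truth_dia, truth_rowBox, truth_box,
    truth_iff, truth_labelVar, truth_chain, Frame.Under]
  constructor
  · rintro ⟨⟨h1, h2, h3⟩, h4⟩
    exact ⟨h1, h2, fun x ⟨z, hz, hx⟩ => ⟨h3 z hz x hx, h4 z hz x hx⟩⟩
  · rintro ⟨h1, h2, h3⟩
    exact ⟨⟨h1, h2, fun z hz x hx => (h3 x ⟨z, hz, hx⟩).1⟩, fun z hz x hx => (h3 x ⟨z, hz, hx⟩).2⟩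

/-- The points of the row of `x` record the configuration `c`. -/
def Records (F : Frame.{u} (Fin 2)) (ν : ℕ → Set F.W) (e : σ → ℕ) (K : ℕ) (c : σ × (ℕ → ℕ))
    (x : F.W) : Prop :=
  x ∈ ν (Label.index e (.state c.1)) ∧ ∀ i < K, ∃ a b, a = c.2 i + b ∧
    Frame.Counts x (ν (Label.index e (.token (i, true)))) a ∧
    Frame.Counts x (ν (Label.index e (.token (i, false)))) b

variable {M}

/-- The removed elements form a subset of the finite set of added ones, so the counter is zero iff
the two sets coincide. -/
theorem truth_zeroTest_of_records (hF : F.IsCommutatorFrame) {r x : F.W} {c : σ × (ℕ → ℕ)}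
    {i : ℕ} (hi : i < K) (hx : F.Under r x)
    (htok : ∀ y, F.Under r y → Truth F ν y (tokenFormula e K)) (hc : Records F ν e K c x) :
    Truth F ν x (zeroTest e i (decide (c.2 i = 0))) := by
  obtain ⟨a, b, hab, ha, hb⟩ := hc.2 i hi
  have hsub : {y | F.Row x y ∧ y ∈ ν (Label.index e (.token (i, false)))} ⊆
      {y | F.Row x y ∧ y ∈ ν (Label.index e (.token (i, true)))} := fun y ⟨hy, hyi⟩ =>
    ⟨hy, (truth_tokenFormula.1 (htok y (hF.under_row hx hy))).2 i hi hyi⟩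
  by_cases h0 : c.2 i = 0
  · simp only [h0, decide_true, zeroTest, truth_neg, truth_nonzero]
    rintro ⟨y, hy, hyi, hyi'⟩
    have heq := Set.eq_of_subset_of_ncard_le hsub (by rw [ha.2.1, hb.2.1]; omega) ha.1
    have : y ∈ {y | F.Row x y ∧ y ∈ ν (Label.index e (.token (i, false)))} := heq ▸ ⟨hy, hyi⟩
    exact hyi' this.2
  · simp only [h0, decide_false, zeroTest, truth_nonzero]
    by_contra! hn
    have hsub' : {y | F.Row x y ∧ y ∈ ν (Label.index e (.token (i, true)))} ⊆
      {y | F.Row x y ∧ y ∈ ν (Label.index e (.token (i, false)))} := fun y ⟨hy, hyi⟩ =>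
      ⟨hy, hn y hy hyi⟩
    have := Set.ncard_le_ncard hsub' hb.1
    rw [ha.2.1, hb.2.1] at this
    omega

theorem counts_of_effect (hF : F.IsCommutatorFrame) {n k : ℕ} {r s x : F.W} {t : ℕ × Bool}
    {a : Option (ℕ × Bool)} (ht : t.1 < K)
    (htok : ∀ y, F.Under r y → Truth F ν y (tokenFormula e K))
    (hs : F.Under r s) (hxs : F.R 0 s x) (hx : F.HasDepth n x) (hsn : F.HasDepth (n + 1) s)
    (he : Truth F ν s (effect e K a))
    (hc : Frame.Counts x (ν (Label.index e (.token t))) k) :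
    (a = some t → Frame.Counts s (ν (Label.index e (.token t))) (k + 1)) ∧
    (a ≠ some t → Frame.Counts s (ν (Label.index e (.token t))) k) := by
  have hX : ∀ y u, F.Under r y → F.R 0 y u → u ∈ ν (Label.index e (.token t)) →
      y ∈ ν (Label.index e (.token t)) := fun y u hy hu =>
    (truth_tokenFormula.1 (htok y hy)).1 t ht u hu
  have hnew : ∀ y, ¬ Truth F ν y (newToken e t) → y ∈ ν (Label.index e (.token t)) →
      ∃ u, F.R 0 y u ∧ u ∈ ν (Label.index e (.token t)) := by
    intro y hy hyX
    by_contra! h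
    exact hy (truth_newToken.2 ⟨hyX, h⟩)
  have h := truth_effect.1 he t ht
  refine ⟨fun hat => ?_, fun hat => ?_⟩
  · obtain ⟨y₀, hy₀, hy₀n, hy₀'⟩ := truth_tokenChanged.1 (h.1 hat)
    exact hF.counts_changed hs hxs hx hsn hX hc hy₀ (truth_newToken.1 hy₀n).1
      (truth_newToken.1 hy₀n).2 fun y hy => hnew y (hy₀' y hy)
  · exact hF.counts_fixed hs hxs hx hsn hX hc fun y hy =>
      hnew y (truth_tokenFixed.1 (h.2 hat) y hy)

/-- Climbing the ladder: from the diagonal point of depth `n` to the `above` point `s` of its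
column, then along the row of `s` to the next diagonal point. The column may change at every step.
-/
theorem exists_records [Fintype σ] (hF : F.IsCommutatorFrame) {m : ℕ} {r : F.W}
    (hK : M.TestsBelow K) (hr : Truth F ν r (M.reduction e K m)) (n : ℕ) :
    ∃ x, F.Under r x ∧ F.HasDepth n x ∧ x ∈ ν (Label.index e .diag) ∧
      Records F ν e K (M.run m n) x := by
  obtain ⟨hinit, habove, hrule⟩ := M.truth_reduction.1 hr
  have htok : ∀ y, F.Under r y → Truth F ν y (tokenFormula e K) := fun y hy =>
    (M.truth_ruleFormula.1 (hrule y hy).1).2.1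
  have hlad := fun y (hy : F.Under r y) =>
    truth_ladderFormula.1 (M.truth_ruleFormula.1 (hrule y hy).1).1
  induction n with
  | zero =>
    obtain ⟨z, hz, x, hx, hxi⟩ := hinit
    obtain ⟨h1, h2, h3, h4⟩ := M.truth_initialFormula.1 hxi
    refine ⟨x, ⟨z, hz, hx⟩, ⟨trivial, fun ⟨u, hu, _⟩ => h2 u hu⟩, h1, h3, fun i hi => ?_⟩
    have : ∀ b, Frame.Counts x (ν (Label.index e (.token (i, b)))) 0 := fun b => by
      have hempty : {y | F.Row x y ∧ y ∈ ν (Label.index e (.token (i, b)))} = ∅ := by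
        ext y
        simpa using h4 (i, b) hi y
      refine ⟨by rw [hempty]; exact Set.finite_empty, by rw [hempty, Set.ncard_empty],
        fun y hy hyX => absurd hyX (h4 (i, b) hi y hy)⟩
    exact ⟨0, 0, rfl, this true, this false⟩
  | succ n ih =>
    obtain ⟨x, ⟨z, hz, hzx⟩, hxn, hxN, hxc⟩ := ih
    obtain ⟨s, hzs, hsS⟩ := habove z hz
    have hs : F.Under r s := ⟨z, hz, hzs⟩
    have hx : F.Under r x := ⟨z, hz, hzx⟩
    obtain ⟨⟨x', hsx', hx'N⟩, himm, y₀, hy₀, hy₀N⟩ := (hlad s hs).2 hsS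
    -- Two diagonal points below `z` would be comparable, but none lies below another.
    have huniq : ∀ u, F.R 0 z u → u ∈ ν (Label.index e .diag) → u = x := by
      intro u hu huN
      rcases hF.linear _ _ _ hu hzx with h | h | h
      · exact absurd hxN ((hlad u ⟨z, hz, hu⟩).1 huN x h)
      · exact h
      · exact absurd huN ((hlad x hx).1 hxN u h)
    obtain rfl : x' = x := huniq x' (hF.trans _ _ _ hzs hsx') hx'N
    -- No successor of `s` has depth above `n`: it is the diagonal point, or by `himm` it is not
    -- over the diagonal point and so lies below it.
    have hsn : F.HasDepth (n + 1) s := by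
      refine ⟨⟨x', hsx', hxn.1⟩, ?_⟩
      rintro ⟨u, hu, huc⟩
      by_cases huN : u ∈ ν (Label.index e .diag)
      · exact hxn.2 (huniq u (hF.trans _ _ _ hzs hu) huN ▸ huc)
      · have := himm u hu huN
        rcases hF.linear _ _ _ hu hsx' with h | h | h
        · exact this x' h hxN
        · exact huN (h ▸ hxN)
        · exact hxn.2 (huc.of_succ |> fun hc => ⟨u, h, hc⟩)
    obtain ⟨-, -, hload, htrans, -⟩ := M.truth_ruleFormula.1 (hrule s hs).1
    -- The row of `s` is written by the action at time `n` and has depth `n + 1`, which explains `m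
    -- + 1` in `reduction`.
    have hloaded : s ∈ ν (Label.index e .loaded) ↔ m ≤ n := by
      rw [(hrule s hs).2, hsn.hasChain_iff]
      omega
    have hstep : Truth F ν s (effect e K (M.runAct m n)) ∧
        ∀ y, F.Row s y → y ∈ ν (Label.index e (.state (M.run m (n + 1)).1)) := by
      by_cases hn : n < m
      · rw [runAct, if_pos hn, M.run_succ_fst_of_lt hn]
        exact M.truth_loadFormula.1 hload hsS (by rw [hloaded]; omega)
      · rw [runAct, if_neg hn, M.run_succ_fst_of_le (by omega)]
        exact M.truth_transitionFormula.1 (htrans _ _) hsS (hloaded.2 (by omega)) x' hsx' hxN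
          hxc.1 (truth_zeroTest_of_records hF (hK _) hx htok hxc)
    refine ⟨y₀, hF.under_row hs hy₀, hF.hasDepth_row hy₀ hsn, hy₀N, hstep.2 y₀ hy₀,
      fun i hi => ?_⟩
    obtain ⟨a, b, hab, ha, hb⟩ := hxc.2 i hi
    have ca := counts_of_effect (t := (i, true)) hF hi htok hs hsx' hxn hsn hstep.1 ha
    have cb := counts_of_effect (t := (i, false)) hF hi htok hs hsx' hxn hsn hstep.1 hb
    rw [M.run_succ_snd]
    have row := fun {X : Set F.W} {k : ℕ} (h : Frame.Counts s X k) => hF.counts_row hy₀ h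
    by_cases h1 : M.runAct m n = some (i, true)
    · refine ⟨a + 1, b, ?_, row (ca.1 h1), row (cb.2 (by simp [h1]))⟩
      simp only [h1, updateCounters, Function.update_self]
      omega
    · by_cases h2 : M.runAct m n = some (i, false)
      · refine ⟨a, b + 1, ?_, row (ca.2 h1), row (cb.1 h2)⟩
        have := M.runAct_dec h2
        simp only [h2, updateCounters, Function.update_self]
        omega
      · refine ⟨a, b, ?_, row (ca.2 h1), row (cb.2 h2)⟩
        rw [hab]
        congr 1
        rcases hact : M.runAct m n with _ | ⟨j, _ | _⟩
        · rfl
        · have : i ≠ j := fun h => h2 (by rw [hact, h])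
          simp [updateCounters, this]
        · have : i ≠ j := fun h => h1 (by rw [hact, h])
          simp [updateCounters, this]

theorem not_halts_of_truth [Fintype σ] (hF : F.IsCommutatorFrame) {m : ℕ} {r : F.W}
    (hK : M.TestsBelow K) (hr : Truth F ν r (M.reduction e K m)) : ¬ M.Halts m := by
  rw [M.halts_iff]
  rintro ⟨n, hn⟩
  obtain ⟨x, hx, -, -, hc⟩ := exists_records hF hK hr n
  have := (M.truth_ruleFormula.1 ((M.truth_reduction.1 hr).2.2 x hx).1).2.2.2.2
  exact this (hn ▸ hc.1)

end Semantics

end CounterMachine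

/-! ### The grid model of a non-halting run -/

namespace Modal

/-- The product frame `⟨ω + 1, >⟩ × ⟨ω, ≠⟩`. -/
abbrev gridFrame : Frame.{0} (Fin 2) := Frame.prod omegaSuccGt omegaNe

def gridPoint (a : WithTop ℕ) (y : ℕ) : gridFrame.W := (a, y)

theorem forall_gridPoint {P : gridFrame.W → Prop} : (∀ x, P x) ↔ ∀ a y, P (gridPoint a y) :=
  ⟨fun h _ _ => h _, fun h x => h x.1 x.2⟩

theorem exists_gridPoint {P : gridFrame.W → Prop} : (∃ x, P x) ↔ ∃ a y, P (gridPoint a y) :=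
  ⟨fun ⟨x, h⟩ => ⟨x.1, x.2, h⟩, fun ⟨_, _, h⟩ => ⟨_, h⟩⟩

theorem exists_eq_natCast_of_lt {a b : WithTop ℕ} (h : b < a) : ∃ n : ℕ, b = n :=
  (WithTop.ne_top_iff_exists.1 (h.trans_le le_top).ne).imp fun _ h => h.symm

theorem grid_R_zero {a b : WithTop ℕ} {y z : ℕ} :
    gridFrame.R 0 (gridPoint a y) (gridPoint b z) ↔ b < a ∧ y = z := Iff.rfl

theorem grid_R_one {a b : WithTop ℕ} {y z : ℕ} :
    gridFrame.R 1 (gridPoint a y) (gridPoint b z) ↔ y ≠ z ∧ a = b := Iff.rfl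

theorem gridPoint_inj {a b : WithTop ℕ} {y z : ℕ} :
    gridPoint a y = gridPoint b z ↔ a = b ∧ y = z := Prod.ext_iff

theorem grid_row {a b : WithTop ℕ} {y z : ℕ} :
    gridFrame.Row (gridPoint a y) (gridPoint b z) ↔ a = b := by
  rw [Frame.Row, gridPoint_inj, grid_R_one]
  tauto

theorem grid_hasChain {n k y : ℕ} : gridFrame.HasChain k (gridPoint n y) ↔ k ≤ n := by
  induction k generalizing n y with
  | zero => simp [Frame.HasChain]
  | succ k ih =>
    rw [Frame.HasChain, exists_gridPoint]
    constructor
    · rintro ⟨b, z, hb, hc⟩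
      have hbn := (grid_R_zero.1 hb).1
      obtain ⟨l, rfl⟩ := exists_eq_natCast_of_lt hbn
      have := ih.1 hc
      have : l < n := by exact_mod_cast hbn
      omega
    · intro h
      exact ⟨(k : ℕ), y, grid_R_zero.2 ⟨by exact_mod_cast h, rfl⟩, ih.2 le_rfl⟩

end Modal

namespace CounterMachine

variable {σ : Type} (M : CounterMachine σ)

/-- The elements that have acquired a token before a given time: increments at time `n` use the
fresh element `n + 1`, decrements the first available element. -/
noncomputable def history (m : ℕ) : ℕ → ℕ × Bool → Finset ℕ
  | 0, _ => ∅
  | n + 1, t => open Classical in if M.runAct m n = some t then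
      insert (if t.2 = true then n + 1
        else sInf {y | y ∈ history m n (t.1, true) ∧ y ∉ history m n (t.1, false)})
        (history m n t)
    else history m n t

/-- The element that acquires the token `t` at time `n`. -/
noncomputable def acquirer (m n : ℕ) (t : ℕ × Bool) : ℕ :=
  if t.2 = true then n + 1
    else sInf {y | y ∈ M.history m n (t.1, true) ∧ y ∉ M.history m n (t.1, false)}

theorem history_succ_of_eq {m n : ℕ} {t : ℕ × Bool} (h : M.runAct m n = some t) :
    M.history m (n + 1) t = insert (M.acquirer m n t) (M.history m n t) := by
  rw [history, if_pos h, acquirer]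

theorem history_succ_of_ne {m n : ℕ} {t : ℕ × Bool} (h : M.runAct m n ≠ some t) :
    M.history m (n + 1) t = M.history m n t := by
  rw [history, if_neg h]

theorem history_mono (m : ℕ) (t : ℕ × Bool) : Monotone fun n => M.history m n t := by
  refine monotone_nat_of_le_succ fun n => ?_
  by_cases h : M.runAct m n = some t
  · simp only [M.history_succ_of_eq h]
    exact Finset.subset_insert _ _
  · simp only [M.history_succ_of_ne h]
    exact le_rfl

/-- Guarantees that the element `n + 1` is still fresh when it is added at time `n`. -/
theorem le_of_mem_history {m n i y : ℕ} (h : y ∈ M.history m n (i, true)) : y ≤ n := by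
  induction n with
  | zero => simp [history] at h
  | succ n ih =>
    by_cases ha : M.runAct m n = some (i, true)
    · rw [M.history_succ_of_eq ha, Finset.mem_insert] at h
      rcases h with rfl | h
      · simp [acquirer]
      · exact (ih h).trans n.le_succ
    · rw [M.history_succ_of_ne ha] at h
      exact (ih h).trans n.le_succ

/-- The claims are proved together: cardinalities at time `n + 1` need that the acquirer at time `n`
is new, and the availability of an element to remove follows from the cardinalities. -/
theorem history_spec (m n i : ℕ) : M.history m n (i, false) ⊆ M.history m n (i, true) ∧
    (M.history m n (i, true)).card = (M.run m n).2 i + (M.history m n (i, false)).card ∧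
    ∀ b, M.runAct m n = some (i, b) → M.acquirer m n (i, b) ∉ M.history m n (i, b) ∧
      (b = false → M.acquirer m n (i, b) ∈ M.history m n (i, true)) := by
  induction n with
  | zero =>
    refine ⟨by simp [history], by simp [history, run], fun b hb => ⟨by simp [history], ?_⟩⟩
    rintro rfl
    exact absurd rfl (M.runAct_dec hb)
  | succ n ih =>
    obtain ⟨hsub, hcard, hacq⟩ := ih
    have h12 : M.history m (n + 1) (i, false) ⊆ M.history m (n + 1) (i, true) ∧
        (M.history m (n + 1) (i, true)).card =
          (M.run m (n + 1)).2 i + (M.history m (n + 1) (i, false)).card := by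
      rw [M.run_succ_snd]
      by_cases h1 : M.runAct m n = some (i, true)
      · have h2 : M.runAct m n ≠ some (i, false) := by simp [h1]
        rw [M.history_succ_of_eq h1, M.history_succ_of_ne h2,
          Finset.card_insert_of_notMem (hacq _ h1).1, h1]
        refine ⟨hsub.trans (Finset.subset_insert _ _), ?_⟩
        simp only [updateCounters, Function.update_self]
        omega
      · by_cases h2 : M.runAct m n = some (i, false)
        · have := M.runAct_dec h2
          rw [M.history_succ_of_eq h2, M.history_succ_of_ne h1,
            Finset.card_insert_of_notMem (hacq _ h2).1, h2]
          refine ⟨Finset.insert_subset ((hacq _ h2).2 rfl) hsub, ?_⟩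
          simp only [updateCounters, Function.update_self]
          omega
        · rw [M.history_succ_of_ne h1, M.history_succ_of_ne h2]
          refine ⟨hsub, hcard.trans ?_⟩
          congr 1
          rcases hact : M.runAct m n with _ | ⟨j, _ | _⟩
          · rfl
          · have : i ≠ j := fun h => h2 (by rw [hact, h])
            simp [updateCounters, this]
          · have : i ≠ j := fun h => h1 (by rw [hact, h])
            simp [updateCounters, this]
    refine ⟨h12.1, h12.2, fun b hb => ?_⟩
    cases b with
    | true =>
      refine ⟨fun h => ?_, by simp⟩
      have := M.le_of_mem_history h
      simp [acquirer] at this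
    | false =>
      have hpos := M.runAct_dec hb
      -- A decrement happens only at a positive counter, so the default value of `sInf` on the empty
      -- set is never used here.
      have hne : {y | y ∈ M.history m (n + 1) (i, true) ∧
          y ∉ M.history m (n + 1) (i, false)}.Nonempty := by
        by_contra hemp
        have hs : M.history m (n + 1) (i, true) ⊆ M.history m (n + 1) (i, false) := by
          intro y hy
          by_contra hy'
          exact hemp ⟨y, hy, hy'⟩
        have := Finset.card_le_card hs
        omega
      have := Nat.sInf_mem hne
      exact ⟨this.2, fun _ => this.1⟩

theorem exists_available_iff (m n i : ℕ) :
    (∃ y, y ∈ M.history m n (i, true) ∧ y ∉ M.history m n (i, false)) ↔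
      (M.run m n).2 i ≠ 0 := by
  obtain ⟨hsub, hcard, -⟩ := M.history_spec m n i
  constructor
  · rintro ⟨y, hy, hy'⟩ h0
    have := Finset.eq_of_subset_of_card_le hsub (by omega)
    exact hy' (this ▸ hy)
  · intro h
    by_contra! hn
    have := Finset.card_le_card (show M.history m n (i, true) ⊆ M.history m n (i, false) from hn)
    omega

/-- The intended interpretation of the labels at the points of the grid. -/
def Label.HoldsAt (m : ℕ) : Label σ → WithTop ℕ → ℕ → Prop
  | diag, a, y => a = (y : ℕ)
  | above, a, y => a = (y + 1 : ℕ)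
  | loaded, a, _ => (m : WithTop ℕ) < a
  | state q, a, _ => ∃ n : ℕ, a = n ∧ (M.run m n).1 = q
  | token t, a, y => ∃ n : ℕ, a = n ∧ y ∈ M.history m n t

def gridValuation (e : σ → ℕ) (m k : ℕ) : Set gridFrame.W :=
  {x | ∃ l : Label σ, l.index e = k ∧ l.HoldsAt M m x.1 x.2}

variable {e : σ → ℕ} (he : Function.Injective e)

include he

theorem mem_gridValuation {m : ℕ} {l : Label σ} {a : WithTop ℕ} {y : ℕ} :
    gridPoint a y ∈ M.gridValuation e m (l.index e) ↔ l.HoldsAt M m a y := by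
  constructor
  · rintro ⟨l', hl, h⟩
    obtain rfl := Label.index_injective he hl
    exact h
  · exact fun h => ⟨l, rfl, h⟩

theorem mem_gridValuation_token {m n y : ℕ} {t : ℕ × Bool} :
    gridPoint n y ∈ M.gridValuation e m (Label.index e (.token t)) ↔ y ∈ M.history m n t := by
  rw [M.mem_gridValuation he]
  constructor
  · rintro ⟨k, hk, h⟩
    obtain rfl : n = k := by exact_mod_cast hk
    exact h
  · exact fun h => ⟨n, rfl, h⟩

theorem mem_gridValuation_state {m n y : ℕ} {q : σ} :
    gridPoint n y ∈ M.gridValuation e m (Label.index e (.state q)) ↔ (M.run m n).1 = q := by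
  rw [M.mem_gridValuation he]
  constructor
  · rintro ⟨k, hk, h⟩
    obtain rfl : n = k := by exact_mod_cast hk
    exact h
  · exact fun h => ⟨n, rfl, h⟩

theorem mem_gridValuation_diag {m n y : ℕ} :
    gridPoint n y ∈ M.gridValuation e m (Label.index e .diag) ↔ n = y := by
  rw [M.mem_gridValuation he]
  exact Nat.cast_inj

theorem mem_gridValuation_above {m n y : ℕ} :
    gridPoint n y ∈ M.gridValuation e m (Label.index e .above) ↔ n = y + 1 := by
  rw [M.mem_gridValuation he]
  exact Nat.cast_inj

theorem mem_gridValuation_loaded {m n y : ℕ} :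
    gridPoint n y ∈ M.gridValuation e m (Label.index e .loaded) ↔ m < n := by
  rw [M.mem_gridValuation he]
  exact Nat.cast_lt

omit he

theorem forall_grid_succ {n y : ℕ} {P : gridFrame.W → Prop} :
    (∀ u, gridFrame.R 0 (gridPoint n y) u → P u) ↔ ∀ k < n, P (gridPoint k y) := by
  rw [forall_gridPoint]
  constructor
  · exact fun h k hk => h k y (grid_R_zero.2 ⟨by exact_mod_cast hk, rfl⟩)
  · rintro h b z hb
    obtain ⟨hbn, rfl⟩ := grid_R_zero.1 hb
    obtain ⟨l, rfl⟩ := exists_eq_natCast_of_lt hbn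
    exact h l (by exact_mod_cast hbn)

theorem forall_grid_row {n y : ℕ} {P : gridFrame.W → Prop} :
    (∀ u, gridFrame.Row (gridPoint n y) u → P u) ↔ ∀ z, P (gridPoint n z) := by
  simp only [forall_gridPoint, grid_row]
  exact ⟨fun h z => h _ z rfl, fun h a z ha => ha ▸ h z⟩

theorem exists_grid_row {n y : ℕ} {P : gridFrame.W → Prop} :
    (∃ u, gridFrame.Row (gridPoint n y) u ∧ P u) ↔ ∃ z, P (gridPoint n z) := by
  simp only [exists_gridPoint, grid_row]
  exact ⟨fun ⟨a, z, ha, h⟩ => ⟨z, ha ▸ h⟩, fun ⟨z, h⟩ => ⟨_, z, rfl, h⟩⟩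

include he

/-- Histories grow, so lacking the token at all earlier times amounts to lacking it at time `n`. -/
theorem grid_truth_newToken {m n y : ℕ} {t : ℕ × Bool} :
    Truth gridFrame (M.gridValuation e m) (gridPoint (n + 1 : ℕ) y) (newToken e t) ↔
      M.runAct m n = some t ∧ y = M.acquirer m n t := by
  rw [truth_newToken, forall_grid_succ, M.mem_gridValuation_token he]
  simp only [M.mem_gridValuation_token he]
  by_cases h : M.runAct m n = some t
  · have hn := ((M.history_spec m n t.1).2.2 t.2 h).1
    rw [M.history_succ_of_eq h, Finset.mem_insert]
    constructor
    · rintro ⟨h1 | h1, h2⟩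
      · exact ⟨h, h1⟩
      · exact absurd h1 (h2 n n.lt_succ_self)
    · rintro ⟨-, rfl⟩
      exact ⟨Or.inl rfl, fun k hk h' => hn (M.history_mono m t (Nat.lt_succ_iff.1 hk) h')⟩
  · rw [M.history_succ_of_ne h]
    constructor
    · rintro ⟨h1, h2⟩
      exact absurd h1 (h2 n n.lt_succ_self)
    · exact fun h' => absurd h'.1 h

theorem grid_truth_effect {m n y K : ℕ} :
    Truth gridFrame (M.gridValuation e m) (gridPoint (n + 1 : ℕ) y)
      (effect e K (M.runAct m n)) := by
  rw [truth_effect]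
  refine fun t _ => ⟨fun h => ?_, fun h => ?_⟩
  · rw [truth_tokenChanged, exists_grid_row]
    refine ⟨M.acquirer m n t, (M.grid_truth_newToken he).2 ⟨h, rfl⟩, ?_⟩
    rw [forall_gridPoint]
    intro a z hz
    obtain ⟨hne, rfl⟩ := grid_R_one.1 hz
    rw [M.grid_truth_newToken he]
    exact fun h' => hne h'.2.symm
  · rw [truth_tokenFixed, forall_grid_row]
    intro z
    rw [M.grid_truth_newToken he]
    exact fun h' => h h'.1

theorem grid_truth_zeroTest {m n y i : ℕ} {z : Bool} :
    Truth gridFrame (M.gridValuation e m) (gridPoint n y) (zeroTest e i z) ↔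
      z = decide ((M.run m n).2 i = 0) := by
  have h : Truth gridFrame (M.gridValuation e m) (gridPoint n y) (nonzero e i) ↔
      (M.run m n).2 i ≠ 0 := by
    rw [truth_nonzero, exists_grid_row, ← M.exists_available_iff]
    simp only [M.mem_gridValuation_token he]
  cases z
  · simpa [zeroTest] using h
  · simpa [zeroTest] using not_congr h

theorem grid_truth_reduction [Fintype σ] {K m : ℕ} (hm : ¬ M.Halts m) :
    Truth gridFrame (M.gridValuation e m) (gridPoint ⊤ 0) (M.reduction e K m) := by
  rw [M.halts_iff, not_exists] at hm
  have hunder : ∀ x, gridFrame.Under (gridPoint ⊤ 0) x → ∃ n y : ℕ, x = gridPoint n y := by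
    rintro x ⟨z, -, hx⟩
    obtain ⟨l, hl⟩ := exists_eq_natCast_of_lt hx.1
    exact ⟨l, x.2, Prod.ext hl rfl⟩
  refine M.truth_reduction.2 ⟨?_, ?_, ?_⟩
  · refine ⟨gridPoint ⊤ 0, Or.inl rfl, gridPoint (0 : ℕ) 0,
      grid_R_zero.2 ⟨WithTop.coe_lt_top 0, rfl⟩, M.truth_initialFormula.2 ⟨?_, ?_, ?_, ?_⟩⟩
    · rw [M.mem_gridValuation_diag he]
    · exact forall_grid_succ.2 (by simp)
    · rw [M.mem_gridValuation_state he]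
      rfl
    · intro t _
      rw [forall_grid_row]
      intro z
      rw [M.mem_gridValuation_token he]
      simp [history]
  · rw [forall_gridPoint]
    rintro a z ha
    obtain rfl := grid_row.1 ha
    exact ⟨gridPoint (z + 1 : ℕ) z, grid_R_zero.2 ⟨WithTop.coe_lt_top _, rfl⟩,
      (M.mem_gridValuation_above he).2 rfl⟩
  · intro x hx
    obtain ⟨n, y, rfl⟩ := hunder x hx
    refine ⟨M.truth_ruleFormula.2 ⟨?_, ?_, ?_, ?_, ?_⟩, ?_⟩
    · rw [truth_ladderFormula]
      simp only [forall_grid_succ, exists_grid_row, M.mem_gridValuation_diag he,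
        M.mem_gridValuation_above he]
      refine ⟨fun h k hk => by omega, ?_⟩
      rintro rfl
      -- The three witnesses are the rungs of the ladder: ⟨y,y⟩ below ⟨y+1,y⟩, nothing between them,
      -- and ⟨y+1,y+1⟩ in its row.
      exact ⟨⟨gridPoint y y, grid_R_zero.2 ⟨by exact_mod_cast y.lt_succ_self, rfl⟩,
        (M.mem_gridValuation_diag he).2 rfl⟩, fun k _ _ l _ => by omega, y + 1, rfl⟩
    · rw [truth_tokenFormula]
      simp only [forall_grid_succ, M.mem_gridValuation_token he]
      exact ⟨fun t _ k hk h => M.history_mono m t hk.le h,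
        fun i _ h => (M.history_spec m n i).1 h⟩
    · rw [truth_loadFormula, M.mem_gridValuation_above he, M.mem_gridValuation_loaded he,
        forall_grid_row]
      rintro rfl hlt
      have hy : y < m := by omega
      refine ⟨?_, fun z => ?_⟩
      · have := M.grid_truth_effect he (m := m) (n := y) (y := y) (K := K)
        rwa [runAct, if_pos hy] at this
      · rw [M.mem_gridValuation_state he, M.run_succ_fst_of_lt hy]
    · intro q z
      rw [truth_transitionFormula, M.mem_gridValuation_above he, M.mem_gridValuation_loaded he,
        forall_grid_succ, forall_grid_row]
      rintro rfl hlt k hk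
      rw [M.mem_gridValuation_diag he, M.mem_gridValuation_state he, M.grid_truth_zeroTest he]
      rintro rfl rfl rfl
      have hact : M.runAct m k = M.act (M.run m k).1 (M.runTest m k) := by
        rw [runAct, if_neg (by omega)]
      refine ⟨?_, fun z => ?_⟩
      · have := M.grid_truth_effect he (m := m) (n := k) (y := k) (K := K)
        rwa [hact] at this
      · rw [M.mem_gridValuation_state he, M.run_succ_fst_of_le (by omega)]
        rfl
    · rw [M.mem_gridValuation_state he]
      exact hm n
    · rw [M.mem_gridValuation_loaded he, grid_hasChain]
      rfl

end CounterMachine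

/-! ### Canonical models for extensions of the commutator -/

namespace Modal

open Formula

theorem subset_smallestLogic {ι : Type} (S : Set (Formula ι)) : S ⊆ smallestLogic S :=
  fun _ hφ _ _ hS => hS hφ

theorem isLogic_smallestLogic {ι : Type} (S : Set (Formula ι)) : IsLogic (smallestLogic S) where
  taut φ h _ hL _ := hL.taut φ h
  axiomK i φ ψ _ hL _ := hL.axiomK i φ ψ
  substitution σ φ h L hL hS := hL.substitution σ φ (h L hL hS)
  modusPonens φ ψ h h' L hL hS := hL.modusPonens φ ψ (h L hL hS) (h' L hL hS)
  necessitation i φ h L hL hS := hL.necessitation i φ (h L hL hS)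

section Canonical

variable {ι : Type}

/-- Compactness of propositional logic. -/
theorem exists_boolean_valuation (Δ : Set (Formula ι))
    (h : ∀ s : Finset (Formula ι), ↑s ⊆ Δ → ∃ v : Formula ι → Prop, (∀ ψ, v (neg ψ) ↔ ¬ v ψ) ∧
      (∀ ψ χ, v (and ψ χ) ↔ v ψ ∧ v χ) ∧ ∀ φ ∈ s, v φ) :
    ∃ v : Formula ι → Prop, (∀ ψ, v (neg ψ) ↔ ¬ v ψ) ∧ (∀ ψ χ, v (and ψ χ) ↔ v ψ ∧ v χ) ∧
      ∀ φ ∈ Δ, v φ := by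
  classical
  have h' : ∀ s : Finset Δ, ∃ v : Formula ι → Prop, (∀ ψ, v (neg ψ) ↔ ¬ v ψ) ∧
      (∀ ψ χ, v (and ψ χ) ↔ v ψ ∧ v χ) ∧ ∀ φ ∈ s, v φ := by
    intro s
    obtain ⟨v, h1, h2, h3⟩ := h (s.image Subtype.val) (by
      intro φ hφ
      obtain ⟨x, -, rfl⟩ := Finset.mem_image.1 hφ
      exact x.2)
    exact ⟨v, h1, h2, fun φ hφ => h3 _ (Finset.mem_image_of_mem _ hφ)⟩
  choose v hneg hand hmem using h'
  -- An ultrafilter containing all cones of finite subsets; limits along it respect negation, and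
  -- each `φ ∈ Δ` is eventually true.
  let U : Ultrafilter (Finset Δ) := Ultrafilter.of Filter.atTop
  refine ⟨fun φ => ∀ᶠ s in U, v s φ, fun ψ => ?_, fun ψ χ => ?_, fun φ hφ => ?_⟩
  · simp only [hneg, Ultrafilter.eventually_not]
  · simp only [hand, Filter.eventually_and]
  · refine Ultrafilter.of_le Filter.atTop ?_
    filter_upwards [Filter.eventually_ge_atTop {⟨φ, hφ⟩}] with s hs
    exact hmem s ⟨φ, hφ⟩ (hs (Finset.mem_singleton_self _))

/-- The maximal consistent sets of a logic. -/
@[ext]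
structure World (L : Set (Formula ι)) where
  holds : Formula ι → Prop
  neg_iff : ∀ ψ, holds (neg ψ) ↔ ¬ holds ψ
  and_iff : ∀ ψ χ, holds (and ψ χ) ↔ holds ψ ∧ holds χ
  of_mem : ∀ φ ∈ L, holds φ

namespace World

variable {L : Set (Formula ι)}

theorem imp_iff (w : World L) (φ ψ : Formula ι) :
    w.holds (imp φ ψ) ↔ (w.holds φ → w.holds ψ) := by
  simp [imp, neg_iff, and_iff]

theorem box_iff_neg (w : World L) (i : ι) (φ : Formula ι) :
    w.holds (box i φ) ↔ ¬ w.holds (dia i (neg φ)) := w.neg_iff _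

theorem top_holds (w : World L) : w.holds top := by
  simp [top, neg_iff, and_iff]

theorem conj_iff (w : World L) (l : List (Formula ι)) :
    w.holds (conj l) ↔ ∀ φ ∈ l, w.holds φ := by
  induction l with
  | nil => simp [conj, top_holds]
  | cons φ l ih => simp [conj, and_iff, ih]

theorem exists_of_finite (Γ : Set (Formula ι))
    (h : ∀ s : Finset (Formula ι), ↑s ⊆ Γ → ∃ w : World L, ∀ φ ∈ s, w.holds φ) :
    ∃ w : World L, ∀ φ ∈ Γ, w.holds φ := by
  classical
  obtain ⟨v, h1, h2, h3⟩ := exists_boolean_valuation (L ∪ Γ) fun s hs => by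
    obtain ⟨w, hw⟩ := h (s.filter (· ∈ Γ)) fun φ hφ => (Finset.mem_filter.1 hφ).2
    refine ⟨w.holds, w.neg_iff, w.and_iff, fun φ hφ => ?_⟩
    rcases hs hφ with hL | hΓ
    · exact w.of_mem φ hL
    · exact hw φ (Finset.mem_filter.2 ⟨hφ, hΓ⟩)
  exact ⟨⟨v, h1, h2, fun φ hφ => h3 φ (Or.inl hφ)⟩, fun φ hφ => h3 φ (Or.inr hφ)⟩

/-- Otherwise `φ` follows propositionally from finitely many members of `L`. In `key`, these are
collected one by one into `θ`, and an occurrence of `neg φ` is dropped by reductio. -/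
theorem exists_not_holds (hL : IsLogic L) {φ : Formula ι} (hφ : φ ∉ L) :
    ∃ w : World L, ¬ w.holds φ := by
  obtain ⟨v, h1, h2, h3⟩ := exists_boolean_valuation (insert (neg φ) L) fun s hs => by
    by_contra! hno
    have key : ∀ l : List (Formula ι), (∀ ψ ∈ l, ψ ∈ insert (neg φ) L) → ∀ θ : Formula ι,
        IsTautology θ ∨ θ ∈ L → (∀ v : Formula ι → Prop, (∀ ψ, v (neg ψ) ↔ ¬ v ψ) →
          (∀ ψ χ, v (and ψ χ) ↔ v ψ ∧ v χ) → v θ → (∀ ψ ∈ l, v ψ) → v φ) → φ ∈ L := by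
      intro l
      induction l with
      | nil =>
        intro _ θ hθ hv
        refine hL.modusPonens θ φ (hL.taut _ fun v hn ha => ?_) (hθ.elim (hL.taut θ) id)
        simp only [imp, hn, ha, not_and, not_not]
        exact fun h => hv v hn ha h (by simp)
      | cons ψ l ih =>
        intro hl θ hθ hv
        have hl' : ∀ χ ∈ l, χ ∈ insert (neg φ) L := fun χ hχ => hl χ (List.mem_cons_of_mem _ hχ)
        rcases hl ψ List.mem_cons_self with rfl | hψ
        · refine ih hl' θ hθ fun v hn ha hvθ hvl => ?_
          by_contra hvφ
          refine hvφ (hv v hn ha hvθ fun χ hχ => ?_)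
          rcases List.mem_cons.1 hχ with rfl | hχ
          exacts [(hn φ).2 hvφ, hvl χ hχ]
        · refine ih hl' (and θ ψ) (Or.inr ?_) fun v hn ha hvθ hvl => ?_
          · refine hL.modusPonens ψ _ (hL.modusPonens θ _ (hL.taut _ fun v hn ha => ?_)
              (hθ.elim (hL.taut θ) id)) hψ
            simp only [imp, hn, ha]
            tauto
          · refine hv v hn ha ((ha _ _).1 hvθ).1 fun χ hχ => ?_
            rcases List.mem_cons.1 hχ with rfl | hχ
            exacts [((ha _ _).1 hvθ).2, hvl χ hχ]
    refine hφ (key s.toList (fun ψ hψ => hs (Finset.mem_toList.1 hψ)) top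
      (Or.inl fun v hn ha => ?_) fun v hn ha _ hvl => ?_)
    · simp [top, hn, ha]
    · obtain ⟨ψ, hψ, hvψ⟩ := hno v hn ha
      exact absurd (hvl ψ (Finset.mem_toList.2 hψ)) hvψ
  exact ⟨⟨v, h1, h2, fun ψ hψ => h3 ψ (Or.inr hψ)⟩, (h1 φ).1 (h3 _ (Or.inl rfl))⟩

/-- The accessibility relations of the canonical frame. -/
def Rel (i : ι) (v w : World L) : Prop := ∀ φ, w.holds φ → v.holds (dia i φ)

end World

end Canonical

/-- A logic that contains `[K4.3, Diff]`, given by generators. -/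
structure ExtendsCommutator (L : Set BimodalFormula) : Prop where
  isLogic : IsLogic L
  linear_mem : ∀ φ ∈ K43.{u}, toBimodal 0 φ ∈ L
  difference_mem : ∀ φ ∈ Diff.{u}, toBimodal 1 φ ∈ L
  commutation_mem : ∀ φ ∈ commutationFormulas, φ ∈ L

theorem extendsCommutator_commutatorLogic :
    ExtendsCommutator.{u} (commutatorLogic K43.{u} Diff.{u}) where
  isLogic := isLogic_smallestLogic _
  linear_mem φ hφ := subset_smallestLogic _
    (Or.inl (subset_smallestLogic _ (Or.inl ⟨φ, hφ, rfl⟩)))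
  difference_mem φ hφ := subset_smallestLogic _
    (Or.inl (subset_smallestLogic _ (Or.inr ⟨φ, hφ, rfl⟩)))
  commutation_mem _ hφ := subset_smallestLogic _ (Or.inr hφ)

theorem ExtendsCommutator.commutatorLogic_subset {L : Set BimodalFormula}
    (hL : ExtendsCommutator.{u} L) : commutatorLogic K43.{u} Diff.{u} ⊆ L := by
  intro φ hφ
  refine hφ L hL.isLogic ?_
  rintro ψ (hψ | hψ)
  · refine hψ L hL.isLogic ?_
    rintro χ (⟨θ, hθ, rfl⟩ | ⟨θ, hθ, rfl⟩)
    exacts [hL.linear_mem θ hθ, hL.difference_mem θ hθ]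
  · exact hL.commutation_mem ψ hψ

/-- Substitutions for the first three variables. -/
def substThree {ι : Type} (a b c : Formula ι) : ℕ → Formula ι
  | 0 => a
  | 1 => b
  | _ => c

namespace ExtendsCommutator

variable {L : Set BimodalFormula} (hL : ExtendsCommutator.{u} L)

include hL

/-- A formula valid in all frames lies in both `K43` and `Diff`. Semantic validity thus replaces
derivations in the minimal normal logic. -/
theorem subst_mem (φ : UnimodalFormula) (h : ∀ F : Frame.{u} Unit, Valid F φ) (i : Fin 2)
    (a b c : BimodalFormula) : subst (substThree a b c) (toBimodal i φ) ∈ L := by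
  refine hL.isLogic.substitution _ _ ?_
  fin_cases i
  · exact hL.linear_mem φ fun F _ => h F
  · exact hL.difference_mem φ fun F _ => h F

theorem exists_of_dia {i : Fin 2} {v : World L} {φ : BimodalFormula} (h : v.holds (dia i φ)) :
    ∃ w : World L, w.holds φ := by
  by_contra! hno
  have hmem : neg φ ∈ L := by
    by_contra hn
    obtain ⟨w, hw⟩ := World.exists_not_holds hL.isLogic hn
    exact hw ((w.neg_iff φ).2 (hno w))
  have h1 := v.of_mem _ (hL.isLogic.necessitation i _ hmem)
  have h2 := v.of_mem _ (hL.subst_mem (imp (box () (neg (var 0))) (neg (dia () (var 0))))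
    (fun F ν w => by simp) i φ φ φ)
  exact (v.neg_iff _).1 ((v.imp_iff _ _).1 h2 h1) h

theorem dia_and {i : Fin 2} {v : World L} {φ ψ : BimodalFormula} (h : v.holds (box i φ))
    (h' : v.holds (dia i ψ)) : v.holds (dia i (and φ ψ)) := by
  have := v.of_mem _ (hL.subst_mem
    (imp (box () (var 0)) (imp (dia () (var 1)) (dia () (and (var 0) (var 1)))))
    (fun F ν w => by
      simp only [truth_imp, truth_box, truth_dia, truth_and]
      rintro h ⟨v, hv, hv'⟩
      exact ⟨v, hv, h v hv, hv'⟩) i φ ψ ψ)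
  exact (v.imp_iff _ _).1 ((v.imp_iff _ _).1 this h) h'

theorem box_neg {i : Fin 2} {v : World L} {φ : BimodalFormula} (h : ¬ v.holds (dia i φ)) :
    v.holds (box i (neg φ)) := by
  have := v.of_mem _ (hL.subst_mem (imp (neg (dia () (var 0))) (box () (neg (var 0))))
    (fun F ν w => by simp) i φ φ φ)
  exact (v.imp_iff _ _).1 this ((v.neg_iff _).2 h)

theorem rel_of_box {i : Fin 2} {v w : World L} (h : ∀ φ, v.holds (box i φ) → w.holds φ) :
    World.Rel i v w := by
  intro φ hφ
  by_contra hn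
  exact (w.neg_iff φ).1 (h _ (hL.box_neg hn)) hφ

omit hL in
theorem holds_of_rel {i : Fin 2} {v w : World L} (h : World.Rel i v w) {φ : BimodalFormula}
    (hb : v.holds (box i φ)) : w.holds φ := by
  by_contra hn
  exact (v.neg_iff _).1 hb (h _ ((w.neg_iff φ).2 hn))

/-- The existence lemma. Finitely many boxed formulas of `v` are pulled under the diamond by
`dia_and`, and compactness gives one world for all of them. -/
theorem dia_iff {i : Fin 2} {v : World L} {φ : BimodalFormula} :
    v.holds (dia i φ) ↔ ∃ w, World.Rel i v w ∧ w.holds φ := by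
  refine ⟨fun h => ?_, fun ⟨w, hw, hφ⟩ => hw φ hφ⟩
  obtain ⟨w, hw⟩ := World.exists_of_finite (L := L) (insert φ {χ | v.holds (box i χ)})
    fun s hs => by
      have key : ∀ l : List BimodalFormula, (∀ χ ∈ l, χ ∈ insert φ {χ | v.holds (box i χ)}) →
          ∃ θ, v.holds (dia i θ) ∧ ∀ w : World L, w.holds θ → w.holds φ ∧ ∀ χ ∈ l, w.holds χ := by
        intro l
        induction l with
        | nil => exact fun _ => ⟨φ, h, fun w hw => ⟨hw, by simp⟩⟩
        | cons χ l ih =>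
          intro hl
          obtain ⟨θ, hθ, hθ'⟩ := ih fun ψ hψ => hl ψ (List.mem_cons_of_mem _ hψ)
          rcases hl χ List.mem_cons_self with rfl | hχ
          · exact ⟨θ, hθ, fun w hw => ⟨(hθ' w hw).1, by
              simpa using ⟨(hθ' w hw).1, (hθ' w hw).2⟩⟩⟩
          · refine ⟨and χ θ, hL.dia_and hχ hθ, fun w hw => ?_⟩
            obtain ⟨h1, h2⟩ := (w.and_iff _ _).1 hw
            exact ⟨(hθ' w h2).1, by simpa using ⟨h1, (hθ' w h2).2⟩⟩
      obtain ⟨θ, hθ, hθ'⟩ := key s.toList fun χ hχ => hs (Finset.mem_toList.1 hχ)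
      obtain ⟨w, hw⟩ := hL.exists_of_dia hθ
      exact ⟨w, fun χ hχ => (hθ' w hw).2 χ (Finset.mem_toList.2 hχ)⟩
  exact ⟨w, hL.rel_of_box fun χ hχ => hw χ (Or.inr hχ), hw φ (Or.inl rfl)⟩

theorem box_iff {i : Fin 2} {v : World L} {φ : BimodalFormula} :
    v.holds (box i φ) ↔ ∀ w, World.Rel i v w → w.holds φ := by
  rw [v.box_iff_neg, hL.dia_iff]
  simp [World.neg_iff]

/-- If `◇ᵢ◇ⱼ` implies `◇ⱼ◇ᵢ` in `L`, then the canonical relations commute accordingly. -/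
theorem rel_comm {i j : Fin 2} (h : imp (box j (box i (var 0))) (box i (box j (var 0))) ∈ L)
    {x y z : World L} (hxy : World.Rel i x y) (hyz : World.Rel j y z) :
    ∃ u, World.Rel j x u ∧ World.Rel i u z := by
  have hax : ∀ ψ, z.holds ψ → x.holds (dia j (dia i ψ)) := by
    intro ψ hψ
    by_contra hn
    rw [hL.dia_iff] at hn
    have h1 : x.holds (box j (box i (neg ψ))) := by
      rw [hL.box_iff]
      intro u hu
      rw [hL.box_iff]
      intro t ht
      rw [World.neg_iff]
      exact fun htψ => hn ⟨u, hu, ht ψ htψ⟩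
    have h2 := x.of_mem _ (hL.isLogic.substitution (fun _ => neg ψ) _ h)
    have h3 := holds_of_rel hyz (holds_of_rel hxy ((x.imp_iff _ _).1 h2 h1))
    exact (z.neg_iff ψ).1 h3 hψ
  obtain ⟨u, hu⟩ := World.exists_of_finite (L := L)
    ({χ | x.holds (box j χ)} ∪ {χ | ∃ ψ, z.holds ψ ∧ χ = dia i ψ}) fun s hs => by
      have : ∀ χ : s, ∃ ψ, z.holds ψ ∧ (x.holds (box j χ) ∨ χ.1 = dia i ψ) := by
        rintro ⟨χ, hχ⟩
        rcases hs hχ with h | ⟨ψ, h, h'⟩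
        · exact ⟨top, z.top_holds, Or.inl h⟩
        · exact ⟨ψ, h, Or.inr h'⟩
      choose f hf hf' using this
      obtain ⟨u, hxu, hu⟩ := hL.dia_iff.1 (hax (conj (s.attach.toList.map f))
        ((z.conj_iff _).2 (List.forall_mem_map.2 fun χ _ => hf χ)))
      obtain ⟨t, hut, ht⟩ := hL.dia_iff.1 hu
      refine ⟨u, fun χ hχ => ?_⟩
      rcases hf' ⟨χ, hχ⟩ with h | h
      · exact holds_of_rel hxu h
      · rw [show χ = _ from h]
        exact hut _ ((t.conj_iff _).1 ht _ (List.mem_map.2 ⟨⟨χ, hχ⟩, by simp, rfl⟩))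
  exact ⟨u, hL.rel_of_box fun χ hχ => hu χ (Or.inl hχ),
    fun ψ hψ => hu _ (Or.inr ⟨ψ, hψ, rfl⟩)⟩

theorem rel_trans {x y z : World L} (hxy : World.Rel 0 x y) (hyz : World.Rel 0 y z) :
    World.Rel 0 x z := by
  intro φ hφ
  have hmem : imp (dia () (dia () (var 0))) (dia () (var 0)) ∈ K43.{u} := by
    rintro F ⟨-, htr, -⟩ ν w
    simp only [truth_imp, truth_dia]
    rintro ⟨v, hv, t, ht, h⟩
    exact ⟨t, htr _ _ _ hv ht, h⟩
  have := x.of_mem _ (hL.isLogic.substitution (fun _ => φ) _ (hL.linear_mem _ hmem))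
  exact (x.imp_iff _ _).1 this (hxy _ (hyz φ hφ))

theorem rel_linear {x y z : World L} (hxy : World.Rel 0 x y) (hxz : World.Rel 0 x z) :
    World.Rel 0 y z ∨ y = z ∨ World.Rel 0 z y := by
  by_contra! hno
  obtain ⟨h1, h2, h3⟩ := hno
  simp only [World.Rel, not_forall] at h1 h3
  obtain ⟨φ, hφ, hφ'⟩ := h1
  obtain ⟨ψ, hψ, hψ'⟩ := h3
  obtain ⟨χ, hχ, hχ'⟩ : ∃ χ, y.holds χ ∧ ¬ z.holds χ := by
    by_contra! hsub
    refine h2 (World.ext (funext fun χ => propext ⟨hsub χ, fun hz => ?_⟩))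
    by_contra hy
    exact (z.neg_iff χ).1 (hsub _ ((y.neg_iff χ).2 hy)) hz
  have hmem : imp (and (dia () (var 0)) (dia () (var 1)))
      (neg (and (neg (dia () (and (var 0) (dia () (var 1)))))
        (and (neg (dia () (and (var 0) (var 1))))
          (neg (dia () (and (var 1) (dia () (var 0)))))))) ∈ K43.{u} := by
    rintro F ⟨-, -, hlin⟩ ν w
    simp only [truth_imp, truth_dia, truth_and, truth_neg]
    rintro ⟨⟨a, ha, ha'⟩, b, hb, hb'⟩ ⟨n1, n2, n3⟩
    rcases hlin a b with h | rfl | h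
    · exact n1 ⟨a, ha, ha', b, h, hb'⟩
    · exact n2 ⟨a, ha, ha', hb'⟩
    · exact n3 ⟨b, hb, hb', a, h, ha'⟩
  -- With `p` true at `y` and `q` true at `z`, each conjunct rules out one case of the linearity
  -- axiom: `¬◇φ` forbids `q` after `p`, `χ` forbids both together, and `¬◇ψ` forbids `p` after `q`.
  let p : BimodalFormula := and ψ (and χ (neg (dia 0 φ)))
  let q : BimodalFormula := and φ (and (neg χ) (neg (dia 0 ψ)))
  have hp : ∀ w : World L, w.holds p ↔ w.holds ψ ∧ w.holds χ ∧ ¬ w.holds (dia 0 φ) := by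
    simp [p, World.and_iff, World.neg_iff]
  have hq : ∀ w : World L, w.holds q ↔ w.holds φ ∧ ¬ w.holds χ ∧ ¬ w.holds (dia 0 ψ) := by
    simp [q, World.and_iff, World.neg_iff]
  have hax := x.of_mem _ (hL.isLogic.substitution (substThree p q q) _ (hL.linear_mem _ hmem))
  replace hax := (x.imp_iff _ _).1 hax ((x.and_iff _ _).2
    ⟨hxy p ((hp y).2 ⟨hψ, hχ, hφ'⟩), hxz q ((hq z).2 ⟨hφ, hχ', hψ'⟩)⟩)
  replace hax := (x.neg_iff _).1 hax
  refine hax ((x.and_iff _ _).2 ⟨(x.neg_iff _).2 fun h => ?_, (x.and_iff _ _).2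
    ⟨(x.neg_iff _).2 fun h => ?_, (x.neg_iff _).2 fun h => ?_⟩⟩)
  · obtain ⟨w, -, hw⟩ := hL.dia_iff.1 h
    obtain ⟨hw1, hw2⟩ := (w.and_iff _ _).1 hw
    obtain ⟨t, hwt, ht⟩ := hL.dia_iff.1 hw2
    exact ((hp w).1 hw1).2.2 (hwt φ ((hq t).1 ht).1)
  · obtain ⟨w, -, hw⟩ := hL.dia_iff.1 h
    obtain ⟨hw1, hw2⟩ := (w.and_iff _ _).1 hw
    exact ((hq w).1 hw2).2.1 ((hp w).1 hw1).2.1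
  · obtain ⟨w, -, hw⟩ := hL.dia_iff.1 h
    obtain ⟨hw1, hw2⟩ := (w.and_iff _ _).1 hw
    obtain ⟨t, hwt, ht⟩ := hL.dia_iff.1 hw2
    exact ((hq w).1 hw1).2.2 (hwt ψ ((hp t).1 ht).1)

theorem rel_symm {x y : World L} (hxy : World.Rel 1 x y) : World.Rel 1 y x := by
  intro φ hφ
  have hmem : imp (var 0) (box () (dia () (var 0))) ∈ Diff.{u} := by
    intro F hF ν w
    simp only [truth_imp, truth_dia, truth_box]
    exact fun h v hv => ⟨w, (hF _ _).2 fun e => (hF _ _).1 hv e.symm, h⟩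
  have := x.of_mem _ (hL.isLogic.substitution (fun _ => φ) _ (hL.difference_mem _ hmem))
  exact holds_of_rel hxy ((x.imp_iff _ _).1 this hφ)

/-- Uses the axiom `◇◇p → (¬p → ◇p)` with `p` a conjunction of a formula refuting `Rel 1 x z` and
one separating `z` from `x`. -/
theorem rel_ptrans {x y z : World L} (hxy : World.Rel 1 x y) (hyz : World.Rel 1 y z) :
    x = z ∨ World.Rel 1 x z := by
  by_contra! hno
  obtain ⟨h1, h2⟩ := hno
  simp only [World.Rel, not_forall] at h2
  obtain ⟨φ, hφ, hφ'⟩ := h2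
  obtain ⟨χ, hχ, hχ'⟩ : ∃ χ, z.holds χ ∧ ¬ x.holds χ := by
    by_contra! hsub
    refine h1 (World.ext (funext fun χ => propext ⟨fun hx => ?_, hsub χ⟩))
    by_contra hz
    exact (x.neg_iff χ).1 (hsub _ ((z.neg_iff χ).2 hz)) hx
  have hmem : imp (dia () (dia () (var 0))) (imp (neg (var 0)) (dia () (var 0))) ∈ Diff.{u} := by
    intro F hF ν w
    simp only [truth_imp, truth_dia, truth_neg]
    rintro ⟨v, -, t, -, ht⟩ hw
    exact ⟨t, (hF _ _).2 fun e => hw (e ▸ ht), ht⟩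
  have := x.of_mem _ (hL.isLogic.substitution (fun _ => and φ χ) _ (hL.difference_mem _ hmem))
  have hd := (x.imp_iff _ _).1 ((x.imp_iff _ _).1 this
    (hxy _ (hyz (and φ χ) ((z.and_iff _ _).2 ⟨hφ, hχ⟩))))
    ((x.neg_iff _).2 fun h => hχ' ((x.and_iff _ _).1 h).2)
  obtain ⟨t, hxt, ht⟩ := hL.dia_iff.1 hd
  exact hφ' (hxt φ ((t.and_iff _ _).1 ht).1)

omit hL in
/-- The canonical frame. -/
def canonicalFrame (L : Set BimodalFormula) (w : World L) : Frame.{0} (Fin 2) where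
  W := World L
  nonempty := ⟨w⟩
  R := World.Rel

theorem isCommutatorFrame_canonicalFrame (w : World L) :
    (canonicalFrame L w).IsCommutatorFrame where
  trans _ _ _ := hL.rel_trans
  linear _ _ _ := hL.rel_linear
  symm _ _ := hL.rel_symm
  ptrans _ _ _ := hL.rel_ptrans
  comm₀₁ _ _ _ := hL.rel_comm (hL.commutation_mem _ (Or.inl rfl))
  comm₁₀ _ _ _ := hL.rel_comm (hL.commutation_mem _ (Or.inr (Or.inl rfl)))

omit hL in
def canonicalValuation (w : World L) (n : ℕ) : Set (canonicalFrame L w).W :=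
  {v | World.holds v (var n)}

theorem truth_canonicalFrame (w : World L) (v : (canonicalFrame L w).W) (φ : BimodalFormula) :
    Truth (canonicalFrame L w) (canonicalValuation w) v φ ↔ World.holds v φ := by
  induction φ generalizing v with
  | var n => exact Iff.rfl
  | neg φ ih => exact (not_congr (ih v)).trans (World.neg_iff v φ).symm
  | and φ ψ ih ih' => exact (and_congr (ih v) (ih' v)).trans (World.and_iff v φ ψ).symm
  | dia i φ ih =>
    exact (exists_congr fun t => and_congr_right fun _ => ih t).trans
      (hL.dia_iff (v := v)).symm

/-- Consistent formulas are satisfied in frames with the properties that correspond to the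
axioms. -/
theorem exists_truth {φ : BimodalFormula} (h : neg φ ∉ L) :
    ∃ (F : Frame.{0} (Fin 2)) (ν : ℕ → Set F.W) (w : F.W),
      F.IsCommutatorFrame ∧ Truth F ν w φ := by
  obtain ⟨w, hw⟩ := World.exists_not_holds hL.isLogic h
  refine ⟨canonicalFrame L w, _, w, hL.isCommutatorFrame_canonicalFrame w,
    (hL.truth_canonicalFrame w w φ).2 ?_⟩
  rw [w.neg_iff] at hw
  exact not_not.1 hw

end ExtendsCommutator

end Modal

-- Products of frames and change of universe

universe v

namespace Modal

open Formula

theorem truth_subst {ι : Type} {F : Frame.{v} ι} {ν : ℕ → Set F.W} {w : F.W}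
    (σ : ℕ → Formula ι) (φ : Formula ι) :
    Truth F ν w (subst σ φ) ↔ Truth F (fun n => {x | Truth F ν x (σ n)}) w φ := by
  induction φ generalizing w with
  | var n => exact Iff.rfl
  | neg φ ih => exact not_congr ih
  | and φ ψ ih ih' => exact and_congr ih ih'
  | dia i φ ih => exact exists_congr fun _ => and_congr_right fun _ => ih

theorem isLogic_log {ι : Type} (C : Set (Frame.{v} ι)) : IsLogic (Log C) where
  taut φ h F _ ν w := h (Truth F ν w) (fun _ => Iff.rfl) fun _ _ => Iff.rfl
  axiomK i φ ψ F _ ν w := by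
    simp only [truth_imp, truth_box]
    exact fun h h' v hv => h v hv (h' v hv)
  substitution σ φ h F hF ν w := (truth_subst σ φ).2 (h F hF _ w)
  modusPonens φ ψ h h' F hF ν w := truth_imp.1 (h F hF ν w) (h' F hF ν w)
  necessitation i φ h F hF ν w := truth_box.2 fun v _ => h F hF ν v

section Product

variable {F₀ F₁ : Frame.{v} Unit} {ν : ℕ → Set (F₀.prod F₁).W}

theorem truth_prod_zero {x : F₀.W} {y : F₁.W} (φ : UnimodalFormula) :
    Truth (F₀.prod F₁) ν (x, y) (toBimodal 0 φ) ↔ Truth F₀ (fun n => {x | (x, y) ∈ ν n}) x φ := by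
  induction φ generalizing x with
  | var n => exact Iff.rfl
  | neg φ ih => exact not_congr ih
  | and φ ψ ih ih' => exact and_congr ih ih'
  | dia i φ ih =>
    constructor
    · rintro ⟨⟨x', y'⟩, ⟨hx, hy⟩, h⟩
      obtain rfl : y = y' := hy
      exact ⟨x', hx, ih.1 h⟩
    · rintro ⟨x', hx, h⟩
      exact ⟨(x', y), ⟨hx, rfl⟩, ih.2 h⟩

theorem truth_prod_one {x : F₀.W} {y : F₁.W} (φ : UnimodalFormula) :
    Truth (F₀.prod F₁) ν (x, y) (toBimodal 1 φ) ↔ Truth F₁ (fun n => {y | (x, y) ∈ ν n}) y φ := by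
  induction φ generalizing y with
  | var n => exact Iff.rfl
  | neg φ ih => exact not_congr ih
  | and φ ψ ih ih' => exact and_congr ih ih'
  | dia i φ ih =>
    constructor
    · rintro ⟨⟨x', y'⟩, ⟨hy, hx⟩, h⟩
      obtain rfl : x = x' := hx
      exact ⟨y', hy, ih.1 h⟩
    · rintro ⟨y', hy, h⟩
      exact ⟨(x, y'), ⟨hy, rfl⟩, ih.2 h⟩

theorem valid_prod_commutationFormulas {φ : BimodalFormula} (h : φ ∈ commutationFormulas) :
    Valid (F₀.prod F₁) φ := by
  intro ν w
  rcases h with rfl | rfl | rfl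
  · simp only [truth_imp, truth_box]
    obtain ⟨x, y⟩ := w
    rintro h ⟨x', y'⟩ ⟨hx, rfl⟩ ⟨x'', y''⟩ ⟨hy, rfl⟩
    exact h (x, y'') ⟨hy, rfl⟩ (x', y'') ⟨hx, rfl⟩
  · simp only [truth_imp, truth_box]
    obtain ⟨x, y⟩ := w
    rintro h ⟨x', y'⟩ ⟨hy, rfl⟩ ⟨x'', y''⟩ ⟨hx, rfl⟩
    exact h (x'', y) ⟨hx, rfl⟩ (x'', y') ⟨hy, rfl⟩
  · simp only [truth_imp, truth_box, truth_dia]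
    obtain ⟨x, y⟩ := w
    rintro ⟨⟨x', y'⟩, ⟨hx, rfl⟩, h⟩ ⟨x'', y''⟩ ⟨hy, rfl⟩
    exact ⟨(x', y''), ⟨hx, rfl⟩, h (x', y'') ⟨hy, rfl⟩⟩

/-- The logic of a class of products of frames for `K4.3` and `Diff` extends the commutator. -/
theorem extendsCommutator_log (C : Set (Frame.{v} (Fin 2)))
    (hC : ∀ F ∈ C, ∃ F₀ F₁ : Frame.{v} Unit,
      IsFrameFor F₀ K43.{u} ∧ IsFrameFor F₁ Diff.{u} ∧ F = F₀.prod F₁) :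
    ExtendsCommutator.{u} (Log C) where
  isLogic := isLogic_log C
  linear_mem φ hφ F hF := by
    obtain ⟨F₀, F₁, h₀, -, rfl⟩ := hC F hF
    rintro ν ⟨x, y⟩
    exact (truth_prod_zero φ).2 (h₀ φ hφ _ x)
  difference_mem φ hφ F hF := by
    obtain ⟨F₀, F₁, -, h₁, rfl⟩ := hC F hF
    rintro ν ⟨x, y⟩
    exact (truth_prod_one φ).2 (h₁ φ hφ _ y)
  commutation_mem φ hφ F hF := by
    obtain ⟨F₀, F₁, -, -, rfl⟩ := hC F hF
    exact valid_prod_commutationFormulas hφ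

end Product

theorem truth_equiv {ι : Type} {F : Frame.{u} ι} {G : Frame.{v} ι} (f : F.W ≃ G.W)
    (hf : ∀ i x y, F.R i x y ↔ G.R i (f x) (f y)) {ν : ℕ → Set G.W} {w : F.W} (φ : Formula ι) :
    Truth F (fun n => f ⁻¹' ν n) w φ ↔ Truth G ν (f w) φ := by
  induction φ generalizing w with
  | var n => exact Iff.rfl
  | neg φ ih => exact not_congr ih
  | and φ ψ ih ih' => exact and_congr ih ih'
  | dia i φ ih =>
    constructor
    · rintro ⟨x, hx, h⟩
      exact ⟨f x, (hf _ _ _).1 hx, ih.1 h⟩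
    · rintro ⟨y, hy, h⟩
      obtain ⟨x, rfl⟩ := f.surjective y
      exact ⟨x, (hf _ _ _).2 hy, ih.2 h⟩

/-- The copy of a frame in a higher universe. -/
def Frame.lift {ι : Type} (F : Frame.{0} ι) : Frame.{u} ι where
  W := ULift.{u} F.W
  nonempty := F.nonempty.map ULift.up
  R i x y := F.R i x.down y.down

theorem truth_lift {ι : Type} {F : Frame.{0} ι} {ν : ℕ → Set F.W} {w : ULift.{u} F.W}
    (φ : Formula ι) :
    Truth F.lift.{u} (fun n => ULift.down ⁻¹' ν n) w φ ↔ Truth F ν w.down φ :=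
  truth_equiv (F := F.lift.{u}) Equiv.ulift (fun _ _ _ => Iff.rfl) φ

theorem valid_of_valid_lift {ι : Type} {F : Frame.{0} ι} {φ : Formula ι}
    (h : Valid F.lift.{u} φ) : Valid F φ :=
  fun _ w => (truth_lift (w := ULift.up w) φ).1 (h _ _)

theorem lift_omegaSuccGt_mem : omegaSuccGt.lift.{u} ∈ linearFrames.{u} := by
  refine ⟨fun x => lt_irrefl (α := WithTop ℕ) x.down, fun x y z hxy hyz =>
    lt_trans (α := WithTop ℕ) hyz hxy, fun x y => ?_⟩
  rcases lt_trichotomy (α := WithTop ℕ) x.down y.down with h | h | h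
  · exact Or.inr (Or.inr h)
  · exact Or.inr (Or.inl (ULift.ext _ _ h))
  · exact Or.inl h

theorem lift_omegaNe_mem : omegaNe.lift.{u} ∈ differenceFrames.{u} := fun _ _ =>
  not_congr ⟨fun h => ULift.ext _ _ h, fun h => congrArg ULift.down h⟩

/-- `K43` and `Diff` are defined by frames in universe `u`, so the factors of the grid are lifted
there to check their validity. -/
theorem isFrameFor_gridFrame :
    IsFrameFor gridFrame (commutatorLogic K43.{u} Diff.{u}) := fun _ hφ =>
  (extendsCommutator_log.{u} {gridFrame} fun _ hF => ⟨omegaSuccGt, omegaNe,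
    fun _ h => valid_of_valid_lift.{u} (h _ lift_omegaSuccGt_mem),
    fun _ h => valid_of_valid_lift.{u} (h _ lift_omegaNe_mem), hF⟩).commutatorLogic_subset hφ
    gridFrame rfl

theorem commutatorLogic_subset_productLogic :
    commutatorLogic K43.{u} Diff.{u} ⊆ productLogic.{u} K43.{u} Diff.{u} :=
  (extendsCommutator_log.{u} _ (by
    rintro F ⟨F₀, h₀, F₁, h₁, h⟩
    exact ⟨F₀, F₁, h₀, h₁, h⟩)).commutatorLogic_subset

theorem valid_gridFrame_of_mem_productLogic {φ : BimodalFormula}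
    (h : φ ∈ productLogic.{u} K43.{u} Diff.{u}) : Valid gridFrame φ := by
  intro ν w
  have := h (omegaSuccGt.lift.{u}.prod omegaNe.lift.{u}) ⟨_, fun _ h => h _ lift_omegaSuccGt_mem,
    _, fun _ h => h _ lift_omegaNe_mem, rfl⟩
  let f : (omegaSuccGt.lift.{u}.prod omegaNe.lift.{u}).W ≃ gridFrame.W :=
    Equiv.prodCongr Equiv.ulift Equiv.ulift
  have hf : ∀ i x y, (omegaSuccGt.lift.{u}.prod omegaNe.lift.{u}).R i x y ↔
      gridFrame.R i (f x) (f y) := by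
    intro i x y
    fin_cases i
    · exact and_congr_right fun _ => ⟨fun h => congrArg ULift.down h, fun h => ULift.ext _ _ h⟩
    · exact and_congr_right fun _ => ⟨fun h => congrArg ULift.down h, fun h => ULift.ext _ _ h⟩
  have := (truth_equiv f hf φ).1 (this (fun n => f ⁻¹' ν n) (f.symm w))
  rwa [Equiv.apply_symm_apply] at this

/-! ### Computability of the reduction -/

section Computability

theorem primrec_neg : Primrec (neg : BimodalFormula → BimodalFormula) :=
  Primrec.encode_iff.1 (Primrec.nat_add.comp
    (Primrec.nat_mul.comp (Primrec.const 5) Primrec.encode) (Primrec.const 1))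

theorem primrec_and : Primrec₂ (and : BimodalFormula → BimodalFormula → BimodalFormula) :=
  Primrec.encode_iff.1 (Primrec.nat_add.comp (Primrec.nat_mul.comp (Primrec.const 5)
    (Primrec₂.natPair.comp (Primrec.encode.comp Primrec.fst) (Primrec.encode.comp Primrec.snd)))
    (Primrec.const 2))

theorem primrec_dia (i : Fin 2) : Primrec (dia i : BimodalFormula → BimodalFormula) :=
  Primrec.encode_iff.1 (Primrec.nat_add.comp (Primrec.nat_add.comp
    (Primrec.nat_mul.comp (Primrec.const 5) Primrec.encode) (Primrec.const 3))
    (Primrec.const i.val))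

theorem primrec_chain : Primrec chain := by
  have h : Primrec fun n : ℕ => (n.rec top fun _ φ => dia 0 φ : BimodalFormula) :=
    Primrec.nat_rec₁ _ ((primrec_dia 0).comp Primrec.snd)
  refine h.of_eq fun n => ?_
  induction n with
  | zero => rfl
  | succ n ih => exact congrArg (dia 0) ih

variable {f g : ℕ → BimodalFormula}

theorem primrec_imp_comp (hf : Primrec f) (hg : Primrec g) : Primrec fun n => imp (f n) (g n) :=
  primrec_neg.comp (primrec_and.comp hf (primrec_neg.comp hg))

theorem primrec_box_comp (i : Fin 2) (hf : Primrec f) : Primrec fun n => box i (f n) :=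
  primrec_neg.comp ((primrec_dia i).comp (primrec_neg.comp hf))

theorem primrec_rowBox_comp (hf : Primrec f) : Primrec fun n => rowBox (f n) :=
  primrec_and.comp hf (primrec_box_comp 1 hf)

theorem primrec_iff_comp (hf : Primrec f) (hg : Primrec g) : Primrec fun n => iff (f n) (g n) :=
  primrec_and.comp (primrec_imp_comp hf hg) (primrec_imp_comp hg hf)

theorem computable_reduction {σ : Type} [Fintype σ] (M : CounterMachine σ) (e : σ → ℕ) (K : ℕ) :
    Computable (M.reduction e K) :=
  (primrec_and.comp (Primrec.const _) (primrec_rowBox_comp (primrec_box_comp 0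
    (primrec_iff_comp (Primrec.const _) (primrec_chain.comp Primrec.succ))))).to_comp

end Computability

/-! ### Correctness of the reduction and the main theorem -/

section Reduction

variable {σ : Type} [Fintype σ] {M : CounterMachine σ} {e : σ → ℕ} {K : ℕ}

theorem neg_reduction_mem (hK : M.TestsBelow K) {m : ℕ} (hm : M.Halts m) :
    neg (M.reduction e K m) ∈ commutatorLogic K43.{u} Diff.{u} := by
  by_contra h
  obtain ⟨F, ν, w, hF, hw⟩ := extendsCommutator_commutatorLogic.exists_truth h
  exact CounterMachine.not_halts_of_truth hF hK hw hm

theorem halts_of_valid (he : Function.Injective e) {m : ℕ}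
    (h : Valid gridFrame (neg (M.reduction e K m))) : M.Halts m := by
  by_contra hm
  exact h _ _ (M.grid_truth_reduction he hm)

/-- Both directions use only inclusions: the refutation lies in `L` because the commutator does, and
the grid model validates `L` by assumption. -/
theorem satisfiable_reduction_iff (he : Function.Injective e) (hK : M.TestsBelow K)
    {L : Set BimodalFormula} (hL : commutatorLogic K43.{u} Diff.{u} ⊆ L)
    (hF : IsFrameFor gridFrame L) (m : ℕ) :
    Satisfiable.{u} L (M.reduction e K m) ↔ ¬ M.Halts m := by
  constructor
  · rintro ⟨F, ν, hν, w, hw⟩ hm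
    exact hν _ (hL (neg_reduction_mem hK hm)) w hw
  · intro hm
    exact ⟨gridFrame.lift.{u}, fun n => ULift.down ⁻¹' M.gridValuation e m n,
      fun ψ hψ w => (truth_lift ψ).2 (hF ψ hψ _ _),
      ULift.up (gridPoint ⊤ 0), (truth_lift _).2 (M.grid_truth_reduction he hm)⟩

end Reduction

end Modal

theorem theorem3 :
    (∀ L : Set BimodalFormula, IsLogic L →
      commutatorLogic K43.{u} Diff.{u} ⊆ L →
      IsFrameFor (Frame.prod omegaSuccGt omegaNe) L →
      ¬ ComputablePred (fun φ : BimodalFormula => Satisfiable.{u} L φ)) ∧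
    ¬ ComputablePred (fun φ : BimodalFormula => φ ∈ commutatorLogic K43.{u} Diff.{u}) ∧
    ¬ ComputablePred (fun φ : BimodalFormula => φ ∈ productLogic.{u} K43.{u} Diff.{u}) := by
  obtain ⟨σ, hσ, M, hM⟩ := exists_undecidable_counterMachine
  have := Fintype.ofFinite σ
  obtain ⟨K, hK⟩ := M.exists_testsBelow
  obtain ⟨e, he⟩ : ∃ e : σ → ℕ, Function.Injective e :=
    ⟨fun q => Fintype.equivFin σ q, fun _ _ h => (Fintype.equivFin σ).injective (Fin.ext h)⟩
  have hneg : Computable fun m => Formula.neg (M.reduction e K m) :=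
    primrec_neg.to_comp.comp (computable_reduction M e K)
  refine ⟨fun L _ hL hF h => hM ?_, fun h => hM ?_, fun h => hM ?_⟩
  · have hr : (fun m => ¬ M.Halts m) ≤₀ fun φ : BimodalFormula => Satisfiable.{u} L φ :=
      ⟨_, computable_reduction M e K, fun m => (satisfiable_reduction_iff he hK hL hF m).symm⟩
    exact (ComputablePred.computable_of_manyOneReducible hr h).not.of_eq fun _ => not_not
  · exact ComputablePred.computable_of_manyOneReducible ⟨_, hneg, fun m =>
      ⟨neg_reduction_mem hK, fun h => halts_of_valid he (isFrameFor_gridFrame _ h)⟩⟩ h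
  · exact ComputablePred.computable_of_manyOneReducible ⟨_, hneg, fun m =>
      ⟨fun hm => commutatorLogic_subset_productLogic (neg_reduction_mem hK hm),
        fun h => halts_of_valid he (valid_gridFrame_of_mem_productLogic h)⟩⟩ h
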